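/- Let $X_1,X_2,\dots$ be independent real random variables with common distribution function $F$, absolutely continuous with density $f$. Let $\varphi_f(t)=\int e^{itx}f(x)\,dx$ and put, in $[0,\infty]$, $$C_f=\sup\{r\ge 0:\varphi_f(t)\neq 0\text{ for a.e. }t\in[0,r]\},\qquad D_f=\sup\{t\ge 0:\varphi_f(t)\neq 0\}.$$ Let $\mathrm{Si}(x)=\int_0^x \frac{\sin z}{\pi z}\,dz$. For $n\ge1$ and $h>0$ let $F_{nh}(x)=\frac12+n^{-1}\sum_{j=1}^n \mathrm{Si}\big((x-X_j)/h\big)$ be the sinc kernel distribution estimator, and for $h=0$ let $F_{n0}$ be the empirical distribution function of $X_1,\dots,X_n$. Put $$\mathrm{MISE}_n(h)=\mathbb E\int_{-\infty}^{\infty}\{F_{nh}(x)-F(x)\}^2dx,\qquad \mathrm{ISB}(h)=\int_{-\infty}^{\infty}\{\mathbb E[F_{nh}(x)]-F(x)\}^2dx$$ (the latter does not depend on $n$) and $h_*=\sup\{h\ge0:\mathrm{ISB}(h)=0\}$. Theorem. Assume that $f$ is square integrable and $\int|x|f(x)\,dx<\infty$. Then, for every $n\ge1$, $\mathrm{MISE}_n(h)$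 is finite for all $h>0$ and there exists $h_{0n}>0$ with $\mathrm{MISE}_n(h_{0n})\le \mathrm{MISE}_n(h)$ for all $h>0$. If moreover $C_f=D_f$, then every sequence $(h_{0n})_{n\ge1}$ of such minimizers satisfies $h_{0n}\to1/D_f$ as $n\to\infty$, and $h_*=1/D_f$ (where $1/D_f=0$ if $D_f=\infty$). -/

import Mathlib

open MeasureTheory ProbabilityTheory Filter Topology
open scoped ENNReal

noncomputable section

namespace SincKDE

/-- The sinc kernel `sin x / (π x)`, with value `1 / π` at `0`. -/
def sincKernel (x : ℝ) : ℝ := Real.sinc x / Real.pi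

/-- The (normalized) sine integral `Si x = ∫₀ˣ sincKernel z dz`, an oriented integral. -/
def Si (x : ℝ) : ℝ := ∫ z in (0 : ℝ)..x, sincKernel z

/-- The sinc kernel distribution estimator at `x`, with bandwidth `h`, from the first `n` values of
the sequence `s`. For `h = 0` it is the empirical distribution function. -/
def estimator (n : ℕ) (h : ℝ) (s : ℕ → ℝ) (x : ℝ) : ℝ :=
  if h = 0 then
    (n : ℝ)⁻¹ * ∑ j ∈ Finset.range n, (Set.Ici (s j)).indicator (fun _ => (1 : ℝ)) x
  else
    1 / 2 + (n : ℝ)⁻¹ * ∑ j ∈ Finset.range n, Si ((x - s j) / h)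

/-- The distribution function `F x = ∫_{-∞}^x f` with density `f`. -/
def distFun (f : ℝ → ℝ) (x : ℝ) : ℝ := ∫ y in Set.Iic x, f y

/-- The Fourier transform `φ_f t = ∫ e^{itx} f x dx`. -/
def phi (f : ℝ → ℝ) (t : ℝ) : ℂ := ∫ x : ℝ, Complex.exp (Complex.I * t * x) * (f x : ℂ)

/-- `C_f = sup {r ≥ 0 : φ_f t ≠ 0 for a.e. t ∈ [0, r]}`, in `[0, ∞]`. -/
def Cf (f : ℝ → ℝ) : ℝ≥0∞ :=
  sSup (ENNReal.ofReal '' {r : ℝ | 0 ≤ r ∧ ∀ᵐ t : ℝ, t ∈ Set.Icc 0 r → phi f t ≠ 0})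

/-- `D_f = sup {t ≥ 0 : φ_f t ≠ 0}`, in `[0, ∞]`. -/
def Df (f : ℝ → ℝ) : ℝ≥0∞ :=
  sSup (ENNReal.ofReal '' {t : ℝ | 0 ≤ t ∧ phi f t ≠ 0})

variable {Ω : Type*} [MeasurableSpace Ω]

/-- The mean integrated squared error `E ∫ (F_{nh}(x) - F(x))² dx`, in `[0, ∞]`. -/
def MISE (P : Measure Ω) (X : ℕ → Ω → ℝ) (f : ℝ → ℝ) (n : ℕ) (h : ℝ) : ℝ≥0∞ :=
  ∫⁻ ω, (∫⁻ x : ℝ, ENNReal.ofReal ((estimator n h (fun j => X j ω) x - distFun f x) ^ 2)) ∂P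

/-- The integrated squared bias `∫ (E[F_{nh}(x)] - F(x))² dx`, in `[0, ∞]`. -/
def ISB (P : Measure Ω) (X : ℕ → Ω → ℝ) (f : ℝ → ℝ) (n : ℕ) (h : ℝ) : ℝ≥0∞ :=
  ∫⁻ x : ℝ, ENNReal.ofReal (((∫ ω, estimator n h (fun j => X j ω) x ∂P) - distFun f x) ^ 2)

/-- `h` minimizes the mean integrated squared error over all positive bandwidths. -/
def IsOptimalBandwidth (P : Measure Ω) (X : ℕ → Ω → ℝ) (f : ℝ → ℝ) (n : ℕ) (h : ℝ) : Prop :=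
  0 < h ∧ ∀ h' : ℝ, 0 < h' → MISE P X f n h ≤ MISE P X f n h'

/-- `h_* = sup {h ≥ 0 : ISB h = 0}`, in `[0, ∞]`. -/
def hStar (P : Measure Ω) (X : ℕ → Ω → ℝ) (f : ℝ → ℝ) (n : ℕ) : ℝ≥0∞ :=
  sSup (ENNReal.ofReal '' {h : ℝ | 0 ≤ h ∧ ISB P X f n h = 0})

end SincKDE

end

/-!
The error `F_{nh} - F` is the inverse Fourier transform of `(ψ_n(w) 1{|w| ≤ W} - ψ(w)) / (2πiw)`,
where `ψ_n` and `ψ` are the Fourier–Stieltjes transforms of the empirical distribution and of the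
law with density `f`, and `W = 1 / (2πh)` is the cutoff frequency of the sinc kernel
(`smoothedCdf_sub_distFun`). This quotient is integrable: near `0` by the finite first moment,
near infinity because `ψ` is square integrable along with `f`. The sine integral itself is not
integrable, so the identity is obtained from increments: by Parseval's identity, and by Fubini's
theorem for the sinc kernel, both sides have the same increments, and the remaining constant
vanishes because both sides, symmetrized, tend to zero at infinity. The value of the Dirichlet
integral is not needed for this.

Plancherel's theorem, together with `E|ψ_n(w) - ψ(w)|² = (1 - |ψ(w)|²) / n`, turns the mean
integrated squared error into twice the `cutoffRisk`

  `q_n(W) = n⁻¹ ∫_0^W (1 - |ψ(w)|²) / (2πw)² dw + ∫_W^∞ |ψ(w)|² / (2πw)² dw`,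

and the integrated squared bias into twice the second summand, the `biasTail`. The rest concerns
this function of one variable.

* A minimizer exists: `q_n` is continuous, it explodes at `0` since `ψ(0) = 1`, and it increases
  for large `W` since `ψ` tends to zero by the Riemann–Lebesgue lemma.
* A minimizer is at most `D_f / (2π)`, because frequencies above this bound only add variance
  (`le_of_isMin`).
* If `2πW₀ < D_f`, then for large `n` all minimizers exceed `W₀`: the bias at `W₀` is positive,
  whereas a suitable fixed large cutoff has a smaller risk as soon as `n` is large
  (`eventually_lt_of_isMin`).
* The bias vanishes if and only if `ψ` vanishes above `W`, which is `h ≤ 1 / D_f`.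
-/

noncomputable section

namespace SincKDE

/-! ### Plancherel's theorem for integrable, square integrable functions -/

section Plancherel

open FourierTransform ComplexInnerProductSpace

/-- The Fourier integral of an integrable and square integrable function represents its `L²` Fourier
transform. -/
lemma coeFn_fourier_toLp {g : ℝ → ℂ} (h1 : Integrable g) (h2 : MemLp g 2) :
    (𝓕 (h2.toLp g) : Lp ℂ 2 (volume : Measure ℝ)) =ᵐ[volume] 𝓕 g := by
  have hc : Continuous (𝓕 g) :=
    VectorFourier.fourierIntegral_continuous Real.continuous_fourierChar continuous_inner h1
  refine ae_eq_of_integral_contDiff_smul_eq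
    ((Lp.memLp _).locallyIntegrable (by norm_num)) hc.locallyIntegrable fun η hη hηs => ?_
  have hη' : ContDiff ℝ (⊤ : ℕ∞) (fun x => (η x : ℂ)) := Complex.ofRealCLM.contDiff.comp hη
  have hηs' : HasCompactSupport (fun x => (η x : ℂ)) := hηs.comp_left Complex.ofReal_zero
  set s : SchwartzMap ℝ ℂ := hηs'.toSchwartzMap hη' with hs
  have hsη : ∀ x, s x = (η x : ℂ) := fun x => rfl
  have key := congrArg (fun T => T s) (Lp.fourier_toTemperedDistribution_eq (h2.toLp g))
  simp only [TemperedDistribution.fourier_apply, Lp.toTemperedDistribution_apply] at key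
  simp only [hsη, Complex.coe_smul] at key
  rw [← key]
  have e1 : ∫ x, (𝓕 s) x • (h2.toLp g) x = ∫ x, (𝓕 s) x • g x :=
    integral_congr_ae (by filter_upwards [h2.coeFn_toLp] with x hx; rw [hx])
  rw [e1]
  have := VectorFourier.integral_fourierIntegral_smul_eq_flip (μ := (volume : Measure ℝ))
    (ν := (volume : Measure ℝ)) (L := innerₗ ℝ)
    Real.continuous_fourierChar continuous_inner (s.integrable (μ := volume)) h1
  rw [flip_innerₗ] at this
  refine this.trans ?_
  refine integral_congr_ae (Eventually.of_forall fun x => ?_)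
  simp only [hsη, Complex.coe_smul]
  rfl

/-- **Parseval's identity** for integrable and square integrable functions. -/
lemma integral_conj_fourier_mul_fourier {g k : ℝ → ℂ} (hg1 : Integrable g) (hg2 : MemLp g 2)
    (hk1 : Integrable k) (hk2 : MemLp k 2) :
    ∫ w, starRingEnd ℂ (𝓕 g w) * 𝓕 k w = ∫ x, starRingEnd ℂ (g x) * k x := by
  have key := Lp.inner_fourier_eq (hg2.toLp g) (hk2.toLp k)
  rw [L2.inner_def, L2.inner_def] at key
  have e1 : ∫ w, starRingEnd ℂ (𝓕 g w) * 𝓕 k w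
      = ∫ w, ⟪(𝓕 (hg2.toLp g) : Lp ℂ 2 (volume : Measure ℝ)) w,
        (𝓕 (hk2.toLp k) : Lp ℂ 2 (volume : Measure ℝ)) w⟫ := by
    refine integral_congr_ae ?_
    filter_upwards [coeFn_fourier_toLp hg1 hg2, coeFn_fourier_toLp hk1 hk2] with w h1 h2
    rw [h1, h2, RCLike.inner_apply, mul_comm]
  rw [e1, key]
  refine integral_congr_ae ?_
  filter_upwards [hg2.coeFn_toLp, hk2.coeFn_toLp] with w h1 h2
  rw [h1, h2, RCLike.inner_apply, mul_comm]

/-- The Fourier integral of an integrable and square integrable function is square integrable. -/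
lemma memLp_fourier {g : ℝ → ℂ} (h1 : Integrable g) (h2 : MemLp g 2) : MemLp (𝓕 g) 2 :=
  (memLp_congr_ae (coeFn_fourier_toLp h1 h2)).1 (Lp.memLp _)

/-- **Plancherel's theorem** for integrable and square integrable functions. -/
lemma lintegral_enorm_sq_fourier {g : ℝ → ℂ} (h1 : Integrable g) (h2 : MemLp g 2) :
    ∫⁻ w, ‖𝓕 g w‖ₑ ^ 2 = ∫⁻ x, ‖g x‖ₑ ^ 2 := by
  have e : eLpNorm (𝓕 g) 2 volume = eLpNorm g 2 volume := by
    have := Lp.norm_fourier_eq (h2.toLp g)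
    rw [Lp.norm_def, Lp.norm_def, ENNReal.toReal_eq_toReal_iff' (Lp.eLpNorm_ne_top _)
      (Lp.eLpNorm_ne_top _)] at this
    rwa [eLpNorm_congr_ae (coeFn_fourier_toLp h1 h2), eLpNorm_congr_ae h2.coeFn_toLp] at this
  have h : ∀ k : ℝ → ℂ, ∫⁻ x, ‖k x‖ₑ ^ 2 = eLpNorm k 2 volume ^ 2 := by
    intro k
    have := eLpNorm_nnreal_pow_eq_lintegral (f := k) (μ := volume) (p := 2) two_ne_zero
    simpa using this.symm
  rw [h, h, e]

end Plancherel

/-! ### The sinc kernel and the sine integral -/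

lemma continuous_sincKernel : Continuous sincKernel :=
  Real.continuous_sinc.div_const _

lemma abs_sincKernel_le_one (x : ℝ) : |sincKernel x| ≤ 1 := by
  rw [sincKernel, abs_div, abs_of_pos Real.pi_pos, div_le_one Real.pi_pos]
  exact (Real.abs_sinc_le_one x).trans (by linarith [Real.pi_gt_three])

lemma abs_sincKernel_le_inv {x : ℝ} (hx : x ≠ 0) : |sincKernel x| ≤ |x|⁻¹ := by
  rw [sincKernel, abs_div, abs_of_pos Real.pi_pos, Real.sinc_of_ne_zero hx, abs_div, div_div,
    ← one_div]
  have h0 := abs_pos.2 hx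
  refine div_le_div₀ zero_le_one (Real.abs_sin_le_one x) h0 ?_
  nlinarith [Real.pi_gt_three]

lemma Si_sub_Si (a b : ℝ) : Si b - Si a = ∫ z in a..b, sincKernel z :=
  intervalIntegral.integral_interval_sub_left (continuous_sincKernel.intervalIntegrable _ _)
    (continuous_sincKernel.intervalIntegrable _ _)

lemma Si_neg (x : ℝ) : Si (-x) = -Si x := by
  have h := intervalIntegral.integral_comp_neg (a := 0) (b := x) sincKernel
  have h2 : ∀ z, sincKernel (-z) = sincKernel z := fun z => by simp [sincKernel]
  simp only [h2, neg_zero] at h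
  rw [Si, intervalIntegral.integral_symm, ← h, Si]

lemma abs_Si_sub_le (a b : ℝ) : |Si b - Si a| ≤ |b - a| := by
  rw [Si_sub_Si]
  simpa using intervalIntegral.norm_integral_le_of_norm_le_const (a := a) (b := b) (C := 1)
    (f := sincKernel) fun x _ => abs_sincKernel_le_one x

lemma continuous_Si : Continuous Si := by
  refine (LipschitzWith.of_dist_le_mul (K := 1) fun x y => ?_).continuous
  simpa [Real.dist_eq] using abs_Si_sub_le y x

lemma abs_Si_le (x : ℝ) : |Si x| ≤ |x| := by
  simpa [Si] using abs_Si_sub_le 0 x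

lemma tendsto_Si_sub_Si (d : ℝ) :
    Tendsto (fun z => Si (z - d) - Si (z + d)) atTop (𝓝 0) := by
  have hb : Tendsto (fun z : ℝ => (z - |d|)⁻¹ * (2 * |d|)) atTop (𝓝 0) := by
    have h1 : Tendsto (fun z : ℝ => z - |d|) atTop atTop := by
      simpa [sub_eq_add_neg] using tendsto_atTop_add_const_right atTop (-|d|) tendsto_id
    simpa using h1.inv_tendsto_atTop.mul_const (2 * |d|)
  refine squeeze_zero_norm' ?_ hb
  filter_upwards [eventually_gt_atTop |d|] with z hz
  rw [Si_sub_Si]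
  have := intervalIntegral.norm_integral_le_of_norm_le_const (a := z + d) (b := z - d)
    (C := (z - |d|)⁻¹) (f := sincKernel) fun x hx => ?_
  · refine this.trans_eq ?_
    rw [show z - d - (z + d) = -(2 * d) by ring, abs_neg, abs_mul, abs_two]
  · have hx' : z - |d| ≤ x := by
      rw [Set.mem_uIoc] at hx
      rcases hx with hx | hx <;> cases abs_cases d <;> linarith
    have hpos : 0 < x := by linarith
    refine (abs_sincKernel_le_inv hpos.ne').trans ?_
    rw [abs_of_pos hpos]
    exact inv_anti₀ (by linarith) hx'

/-- The Fourier transform of the indicator function of `[-W, W]` is a rescaled sinc kernel. -/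
lemma integral_exp_eq_sincKernel {h : ℝ} (hh : 0 < h) (z : ℝ) :
    ∫ w in (-(1 / (2 * Real.pi * h)))..(1 / (2 * Real.pi * h)),
      Complex.exp ((2 * Real.pi * z * w : ℝ) * Complex.I) = ((sincKernel (z / h) / h : ℝ) : ℂ) := by
  have hpi := Real.pi_pos
  rcases eq_or_ne z 0 with rfl | hz
  · simp only [mul_zero, zero_mul, Complex.ofReal_zero, Complex.exp_zero, zero_div, sincKernel,
      Real.sinc_zero, intervalIntegral.integral_const, sub_neg_eq_add, Complex.real_smul, mul_one]
    congr 1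
    field_simp
    norm_num
  · have hc : 2 * Real.pi * z ≠ 0 := by positivity
    have := intervalIntegral.integral_comp_mul_left (a := -(1 / (2 * Real.pi * h)))
      (b := 1 / (2 * Real.pi * h)) (fun t : ℝ => Complex.exp (t * Complex.I)) hc
    rw [this, mul_neg, integral_exp_mul_I_eq_sinc]
    have e : 2 * Real.pi * z * (1 / (2 * Real.pi * h)) = z / h := by field_simp
    rw [e, sincKernel, Complex.real_smul]
    push_cast
    have hz' : (z : ℂ) ≠ 0 := by exact_mod_cast hz
    have hp' : (Real.pi : ℂ) ≠ 0 := by exact_mod_cast hpi.ne'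
    have hh' : (h : ℂ) ≠ 0 := by exact_mod_cast hh.ne'
    field_simp

/-- The inverse Fourier transform `∫_a^b e^{2πixw} dx` of the indicator function of `[a, b]`. -/
def intervalTransform (a b w : ℝ) : ℂ :=
  ∫ x in a..b, Complex.exp ((2 * Real.pi * x * w : ℝ) * Complex.I)

lemma continuous_intervalTransform (a b : ℝ) : Continuous (intervalTransform a b) := by
  unfold intervalTransform
  exact intervalIntegral.continuous_parametric_intervalIntegral_of_continuous' (by fun_prop) a b

lemma norm_intervalTransform_le (a b w : ℝ) : ‖intervalTransform a b w‖ ≤ |b - a| := by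
  rw [← one_mul |b - a|]
  exact intervalIntegral.norm_integral_le_of_norm_le_const (a := a) (b := b) (C := 1)
    (f := fun x : ℝ => Complex.exp ((2 * Real.pi * x * w : ℝ) * Complex.I))
    fun x _ => (Complex.norm_exp_ofReal_mul_I _).le

lemma mul_intervalTransform (a b w : ℝ) :
    2 * Real.pi * w * Complex.I * intervalTransform a b w =
      Complex.exp ((2 * Real.pi * b * w : ℝ) * Complex.I)
        - Complex.exp ((2 * Real.pi * a * w : ℝ) * Complex.I) := by
  rcases eq_or_ne w 0 with rfl | hw
  · simp
  have hc : (2 * Real.pi * w * Complex.I : ℂ) ≠ 0 := by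
    simp [Real.pi_ne_zero, hw]
  have := integral_exp_mul_complex (a := a) (b := b) hc
  have e : ∀ x : ℝ, Complex.exp ((2 * Real.pi * x * w : ℝ) * Complex.I)
      = Complex.exp (2 * Real.pi * w * Complex.I * x) := fun x => by
    congr 1; push_cast; ring
  simp_rw [intervalTransform, e]
  rw [this, mul_div_cancel₀ _ hc]

/-- The increment of the rescaled sine integral is a band-limited Fourier integral. -/
lemma Si_increment {h : ℝ} (hh : 0 < h) (a b y : ℝ) :
    ((Si ((b - y) / h) - Si ((a - y) / h) : ℝ) : ℂ) =
      ∫ w in (-(1 / (2 * Real.pi * h)))..(1 / (2 * Real.pi * h)),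
        Complex.exp ((-(2 * Real.pi * w) * y : ℝ) * Complex.I) * intervalTransform a b w := by
  have e1 : Si ((b - y) / h) - Si ((a - y) / h) = ∫ x in a..b, sincKernel ((x - y) / h) / h := by
    have := intervalIntegral.inv_smul_integral_comp_div_sub (a := a) (b := b) sincKernel h (y / h)
    rw [Si_sub_Si, sub_div, sub_div, ← this, ← intervalIntegral.integral_smul]
    refine intervalIntegral.integral_congr fun x _ => ?_
    simp only [smul_eq_mul, sub_div]
    ring
  rw [e1, ← intervalIntegral.integral_ofReal]
  simp_rw [← integral_exp_eq_sincKernel hh, intervalTransform,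
    ← intervalIntegral.integral_const_mul]
  rw [intervalIntegral_intervalIntegral_swap]
  · refine intervalIntegral.integral_congr fun w _ =>
      intervalIntegral.integral_congr fun x _ => ?_
    rw [← Complex.exp_add]
    congr 1
    push_cast
    ring
  · refine Integrable.mono' (g := fun _ => 1) ?_ ?_ ?_
    · refine integrableOn_const ?_
      rw [Measure.volume_eq_prod, Measure.prod_prod]
      simp [Set.uIoc, ENNReal.mul_eq_top]
    · exact Continuous.aestronglyMeasurable (by unfold Function.uncurry; fun_prop)
    · exact Eventually.of_forall fun p => (Complex.norm_exp_ofReal_mul_I _).le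

/-! ### Fourier–Stieltjes transforms and the transform of the error -/

/-- The Fourier–Stieltjes transform `w ↦ ∫ e^{-2πiwy} dν(y)`, in the normalization of Mathlib's
Fourier transform. -/
def stieltjesFourier (ν : Measure ℝ) (w : ℝ) : ℂ :=
  ∫ y, Complex.exp ((-(2 * Real.pi * w) * y : ℝ) * Complex.I) ∂ν

section StieltjesFourier

variable (ν : Measure ℝ) [IsProbabilityMeasure ν]

lemma integrable_exp_ofReal_mul_I {α : Type*} [MeasurableSpace α] {m : Measure α}
    [IsFiniteMeasure m] {θ : α → ℝ} (hθ : AEMeasurable θ m) :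
    Integrable (fun y => Complex.exp ((θ y : ℝ) * Complex.I)) m := by
  refine Integrable.mono' (g := fun _ => 1) (integrable_const _) ?_ ?_
  · exact (Complex.measurable_exp.comp_aemeasurable
      ((Complex.measurable_ofReal.comp_aemeasurable hθ).mul_const _)).aestronglyMeasurable
  · exact Eventually.of_forall fun p => (Complex.norm_exp_ofReal_mul_I _).le

lemma continuous_stieltjesFourier : Continuous (stieltjesFourier ν) := by
  refine continuous_of_dominated (bound := fun _ => 1) (fun w => ?_) (fun w => ?_)
    (integrable_const _) (Eventually.of_forall fun y => by fun_prop)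
  · exact Continuous.aestronglyMeasurable (by fun_prop)
  · exact Eventually.of_forall fun y => (Complex.norm_exp_ofReal_mul_I _).le

lemma norm_stieltjesFourier_le (w : ℝ) : ‖stieltjesFourier ν w‖ ≤ 1 := by
  refine (norm_integral_le_integral_norm _).trans ?_
  simp only [Complex.norm_exp_ofReal_mul_I]
  simp

lemma stieltjesFourier_zero : stieltjesFourier ν 0 = 1 := by
  simp [stieltjesFourier]

lemma norm_stieltjesFourier_sub_one_le (hν : Integrable (fun y => |y|) ν) (w : ℝ) :
    ‖stieltjesFourier ν w - 1‖ ≤ 2 * Real.pi * |w| * ∫ y, |y| ∂ν := by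
  have e : stieltjesFourier ν w - 1
      = ∫ y, (Complex.exp ((-(2 * Real.pi * w) * y : ℝ) * Complex.I) - 1) ∂ν := by
    rw [integral_sub (integrable_exp_ofReal_mul_I (by fun_prop)) (integrable_const _)]
    simp [stieltjesFourier]
  rw [e, ← integral_const_mul]
  refine norm_integral_le_of_norm_le (hν.const_mul _) (Eventually.of_forall fun y => ?_)
  have := Real.norm_exp_I_mul_ofReal_sub_one_le (x := -(2 * Real.pi * w) * y)
  rw [mul_comm Complex.I] at this
  refine this.trans_eq ?_
  rw [Real.norm_eq_abs, abs_mul, abs_neg, abs_mul, abs_of_pos Real.two_pi_pos]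

end StieltjesFourier

/-- The Fourier transform of the difference of the distribution function of `ν`, smoothed by the
sinc kernel with cutoff frequency `W`, and of the distribution function of `μ`. -/
def errorTransform (ν μ : Measure ℝ) (W w : ℝ) : ℂ :=
  ((Set.Icc (-W) W).indicator (stieltjesFourier ν) w - stieltjesFourier μ w)
    / (2 * Real.pi * w * Complex.I)

section ErrorTransform

lemma lt_abs_of_notMem_Icc {W w : ℝ} (hw : w ∉ Set.Icc (-W) W) : W < |w| := by
  rw [Set.mem_Icc, ← abs_le] at hw
  exact not_le.1 hw

lemma inv_sq_abs_le {W w : ℝ} (hW : 0 < W) (hw : W < |w|) :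
    (|w| ^ 2)⁻¹ ≤ (1 + (W ^ 2)⁻¹) * (1 + w ^ 2)⁻¹ := by
  have h0 : 0 < |w| := hW.trans hw
  rw [← sq_abs w, ← div_eq_mul_inv, inv_le_comm₀ (by positivity) (by positivity), inv_div,
    div_le_iff₀ (by positivity)]
  have : 1 ≤ |w| ^ 2 * (W ^ 2)⁻¹ := by
    rw [← div_eq_mul_inv, one_le_div (by positivity)]
    exact pow_le_pow_left₀ hW.le hw.le 2
  nlinarith

lemma norm_errorTransform_of_notMem {ν μ : Measure ℝ} {W w : ℝ} (hw : w ∉ Set.Icc (-W) W) :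
    ‖errorTransform ν μ W w‖ = ‖stieltjesFourier μ w‖ / (2 * Real.pi * |w|) := by
  rw [errorTransform, Set.indicator_of_notMem hw, norm_div]
  simp [abs_of_pos Real.pi_pos]

variable {ν μ : Measure ℝ} [IsProbabilityMeasure ν] [IsProbabilityMeasure μ]

lemma measurable_errorTransform (W : ℝ) : Measurable (errorTransform ν μ W) := by
  have h1 := (continuous_stieltjesFourier ν).measurable
  have h2 := (continuous_stieltjesFourier μ).measurable
  unfold errorTransform
  exact ((h1.indicator measurableSet_Icc).sub h2).div (by fun_prop)

lemma norm_errorTransform_of_mem (hν : Integrable (fun y => |y|) ν)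
    (hμ : Integrable (fun y => |y|) μ) {W w : ℝ} (hw : w ∈ Set.Icc (-W) W) :
    ‖errorTransform ν μ W w‖ ≤ ∫ y, |y| ∂ν + ∫ y, |y| ∂μ := by
  rw [errorTransform, Set.indicator_of_mem hw, norm_div]
  have hn : ‖(2 * Real.pi * w * Complex.I : ℂ)‖ = 2 * Real.pi * |w| := by
    simp [abs_of_pos Real.pi_pos]
  rw [hn]
  refine div_le_of_le_mul₀ (by positivity) (by positivity) ?_
  calc ‖stieltjesFourier ν w - stieltjesFourier μ w‖
      = ‖(stieltjesFourier ν w - 1) - (stieltjesFourier μ w - 1)‖ := by ring_nf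
    _ ≤ ‖stieltjesFourier ν w - 1‖ + ‖stieltjesFourier μ w - 1‖ := norm_sub_le _ _
    _ ≤ _ := by
      have h1 := norm_stieltjesFourier_sub_one_le ν hν w
      have h2 := norm_stieltjesFourier_sub_one_le μ hμ w
      linarith

lemma integrable_errorTransform (hν : Integrable (fun y => |y|) ν)
    (hμ : Integrable (fun y => |y|) μ) (h2 : MemLp (stieltjesFourier μ) 2 volume)
    {W : ℝ} (hW : 0 < W) : Integrable (errorTransform ν μ W) := by
  have hb : Integrable (fun w : ℝ =>
      (Set.Icc (-W) W).indicator (fun _ => ∫ y, |y| ∂ν + ∫ y, |y| ∂μ) w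
        + ‖stieltjesFourier μ w‖ ^ 2 + (1 + (W ^ 2)⁻¹) * (1 + w ^ 2)⁻¹) := by
    refine Integrable.add (Integrable.add ?_ ?_) (integrable_inv_one_add_sq.const_mul _)
    · exact (integrable_indicator_iff measurableSet_Icc).2
        (integrableOn_const (by simp))
    · exact (memLp_two_iff_integrable_sq_norm h2.1).1 h2
  refine hb.mono' (measurable_errorTransform W).aestronglyMeasurable
    (Eventually.of_forall fun w => ?_)
  by_cases hw : w ∈ Set.Icc (-W) W
  · rw [Set.indicator_of_mem hw]
    refine (norm_errorTransform_of_mem hν hμ hw).trans ?_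
    have : 0 ≤ (1 + (W ^ 2)⁻¹) * (1 + w ^ 2)⁻¹ := by positivity
    nlinarith [sq_nonneg ‖stieltjesFourier μ w‖]
  · rw [Set.indicator_of_notMem hw, norm_errorTransform_of_notMem hw, zero_add]
    have hWw := lt_abs_of_notMem_Icc hw
    have h0 : 0 < |w| := hW.trans hWw
    have h1 := inv_sq_abs_le hW hWw
    have h3 : ‖stieltjesFourier μ w‖ / (2 * Real.pi * |w|) ≤ ‖stieltjesFourier μ w‖ * |w|⁻¹ := by
      rw [div_eq_mul_inv]
      refine mul_le_mul_of_nonneg_left (inv_anti₀ h0 ?_) (norm_nonneg _)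
      nlinarith [Real.pi_gt_three]
    rw [← inv_pow] at h1
    -- arithmetic-geometric mean inequality for the square integrable factors `|ψ|`, `1 / |w|`
    nlinarith [sq_nonneg (‖stieltjesFourier μ w‖ - |w|⁻¹), sq_nonneg (‖stieltjesFourier μ w‖),
      sq_nonneg (|w|⁻¹)]

lemma memLp_errorTransform (hν : Integrable (fun y => |y|) ν)
    (hμ : Integrable (fun y => |y|) μ) (h2 : MemLp (stieltjesFourier μ) 2 volume)
    {W : ℝ} (hW : 0 < W) : MemLp (errorTransform ν μ W) 2 := by
  rw [memLp_two_iff_integrable_sq_norm (measurable_errorTransform W).aestronglyMeasurable]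
  have hM : 0 ≤ ∫ y, |y| ∂ν + ∫ y, |y| ∂μ := by positivity
  have hb : ∀ w, ‖errorTransform ν μ W w‖ ≤ ∫ y, |y| ∂ν + ∫ y, |y| ∂μ + W⁻¹ := fun w => by
    by_cases hw : w ∈ Set.Icc (-W) W
    · have := inv_pos.2 hW
      linarith [norm_errorTransform_of_mem hν hμ hw]
    · rw [norm_errorTransform_of_notMem hw]
      have hWw := lt_abs_of_notMem_Icc hw
      have : ‖stieltjesFourier μ w‖ / (2 * Real.pi * |w|) ≤ 1 / W :=
        div_le_div₀ zero_le_one (norm_stieltjesFourier_le μ w) hW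
          (by nlinarith [Real.pi_gt_three])
      rw [one_div] at this
      linarith
  refine ((integrable_errorTransform hν hμ h2 hW).norm.const_mul
    (∫ y, |y| ∂ν + ∫ y, |y| ∂μ + W⁻¹)).mono'
    ((measurable_errorTransform W).norm.pow_const 2).aestronglyMeasurable
    (Eventually.of_forall fun w => ?_)
  rw [Real.norm_of_nonneg (sq_nonneg _), sq]
  exact mul_le_mul_of_nonneg_right (hb w) (norm_nonneg _)

end ErrorTransform

/-! ### The error as an inverse Fourier transform -/

/-- The probability distribution on the line with density `f`. -/
abbrev densityLaw (f : ℝ → ℝ) : Measure ℝ := volume.withDensity (fun x => ENNReal.ofReal (f x))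

section Density

open FourierTransform

variable {f : ℝ → ℝ} (hf_meas : Measurable f) (hf_nonneg : ∀ x, 0 ≤ f x)
  [IsProbabilityMeasure (densityLaw f)]

include hf_meas hf_nonneg

lemma integrable_density : Integrable f := by
  refine ⟨hf_meas.aestronglyMeasurable, ?_⟩
  rw [hasFiniteIntegral_iff_ofReal (Eventually.of_forall hf_nonneg)]
  have : densityLaw f Set.univ = 1 := measure_univ
  rw [densityLaw, withDensity_apply _ MeasurableSet.univ, Measure.restrict_univ] at this
  simp [this]

omit [IsProbabilityMeasure (densityLaw f)] in
lemma integral_densityLaw {E : Type*} [NormedAddCommGroup E] [NormedSpace ℝ E] (g : ℝ → E) :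
    ∫ y, g y ∂(densityLaw f) = ∫ y, f y • g y := by
  rw [integral_withDensity_eq_integral_toReal_smul hf_meas.ennreal_ofReal
    (Eventually.of_forall fun _ => ENNReal.ofReal_lt_top)]
  simp [ENNReal.toReal_ofReal (hf_nonneg _)]

omit [IsProbabilityMeasure (densityLaw f)] in
lemma integrable_abs_densityLaw (hf_mean : Integrable (fun x : ℝ => |x| * f x) volume) :
    Integrable (fun y => |y|) (densityLaw f) := by
  rw [integrable_withDensity_iff hf_meas.ennreal_ofReal
    (Eventually.of_forall fun _ => ENNReal.ofReal_lt_top)]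
  simpa [ENNReal.toReal_ofReal (hf_nonneg _)] using hf_mean

omit [IsProbabilityMeasure (densityLaw f)] in
lemma stieltjesFourier_densityLaw :
    stieltjesFourier (densityLaw f) = 𝓕 (fun x => (f x : ℂ)) := by
  ext w
  rw [stieltjesFourier, integral_densityLaw hf_meas hf_nonneg,
    Real.fourier_real_eq_integral_exp_smul]
  refine integral_congr_ae (Eventually.of_forall fun y => ?_)
  simp only [Complex.real_smul, smul_eq_mul]
  rw [mul_comm, show -(2 * Real.pi * w) * y = -2 * Real.pi * y * w by ring]

lemma memLp_stieltjesFourier_densityLaw (hf_sq : MemLp f 2 volume) :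
    MemLp (stieltjesFourier (densityLaw f)) 2 volume := by
  rw [stieltjesFourier_densityLaw hf_meas hf_nonneg]
  exact memLp_fourier (integrable_density hf_meas hf_nonneg).ofReal hf_sq.ofReal

lemma distFun_eq_cdf (x : ℝ) : distFun f x = cdf (densityLaw f) x := by
  rw [cdf_eq_real, measureReal_def, withDensity_apply _ measurableSet_Iic, distFun,
    integral_eq_lintegral_of_nonneg_ae (Eventually.of_forall hf_nonneg)
      hf_meas.aestronglyMeasurable]

lemma distFun_sub (a b : ℝ) : distFun f b - distFun f a = ∫ x in a..b, f x :=
  intervalIntegral.integral_Iic_sub_Iic (integrable_density hf_meas hf_nonneg).integrableOn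
    (integrable_density hf_meas hf_nonneg).integrableOn

/-- Parseval's identity for the density and the indicator function of `(a, b]`. -/
lemma integral_intervalTransform_mul (hf_sq : MemLp f 2 volume) {a b : ℝ} (hab : a ≤ b) :
    ∫ w, intervalTransform a b w * stieltjesFourier (densityLaw f) w
      = ((distFun f b - distFun f a : ℝ) : ℂ) := by
  have hg : Integrable ((Set.Ioc a b).indicator (fun _ => (1 : ℂ))) :=
    (integrable_indicator_iff measurableSet_Ioc).2 (integrableOn_const (by simp))
  have hg2 : MemLp ((Set.Ioc a b).indicator (fun _ => (1 : ℂ))) 2 volume :=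
    memLp_indicator_const 2 measurableSet_Ioc 1 (Or.inr (by simp))
  have key := integral_conj_fourier_mul_fourier hg hg2
    (integrable_density hf_meas hf_nonneg).ofReal hf_sq.ofReal
  have e1 : ∀ w, starRingEnd ℂ (𝓕 ((Set.Ioc a b).indicator (fun _ => (1 : ℂ))) w)
      = intervalTransform a b w := fun w => by
    rw [Real.fourier_real_eq_integral_exp_smul, ← integral_conj, intervalTransform,
      intervalIntegral.integral_of_le hab, ← integral_indicator measurableSet_Ioc]
    refine integral_congr_ae (Eventually.of_forall fun y => ?_)
    by_cases hy : y ∈ Set.Ioc a b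
    · simp only [Set.indicator_of_mem hy, smul_eq_mul, mul_one, ← Complex.exp_conj, map_mul,
        Complex.conj_I, Complex.conj_ofReal]
      congr 1
      push_cast
      ring
    · simp [Set.indicator_of_notMem hy]
  simp_rw [e1] at key
  rw [stieltjesFourier_densityLaw hf_meas hf_nonneg]
  refine key.trans ?_
  rw [distFun_sub hf_meas hf_nonneg, intervalIntegral.integral_of_le hab,
    ← integral_indicator measurableSet_Ioc, ← integral_complex_ofReal]
  refine integral_congr_ae (Eventually.of_forall fun y => ?_)
  by_cases hy : y ∈ Set.Ioc a b
  · simp [Set.indicator_of_mem hy]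
  · simp [Set.indicator_of_notMem hy]

end Density

section Smoothed

variable {ν : Measure ℝ} [IsProbabilityMeasure ν]

/-- The distribution function of `ν` smoothed by the sinc kernel with bandwidth `h`. -/
def smoothedCdf (ν : Measure ℝ) (h x : ℝ) : ℝ := 1 / 2 + ∫ y, Si ((x - y) / h) ∂ν

lemma integrable_Si (hν : Integrable (fun y => |y|) ν) (h x : ℝ) :
    Integrable (fun y => Si ((x - y) / h)) ν := by
  refine (((integrable_const |x|).add hν).div_const |h|).mono'
    (continuous_Si.comp (by fun_prop)).aestronglyMeasurable (Eventually.of_forall fun y => ?_)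
  refine (abs_Si_le _).trans ?_
  rw [abs_div]
  exact div_le_div_of_nonneg_right (abs_sub _ _) (abs_nonneg _)

/-- The increments of the smoothed distribution function in the frequency domain. -/
lemma integral_intervalTransform_indicator {h : ℝ} (hh : 0 < h)
    (hν : Integrable (fun y => |y|) ν) (a b : ℝ) :
    ∫ w, intervalTransform a b w * (Set.Icc (-(1 / (2 * Real.pi * h)))
        (1 / (2 * Real.pi * h))).indicator (stieltjesFourier ν) w
      = ((smoothedCdf ν h b - smoothedCdf ν h a : ℝ) : ℂ) := by
  have hpi := Real.pi_pos
  have hW : 0 < 1 / (2 * Real.pi * h) := by positivity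
  have e1 : smoothedCdf ν h b - smoothedCdf ν h a
      = ∫ y, (Si ((b - y) / h) - Si ((a - y) / h)) ∂ν := by
    rw [integral_sub (integrable_Si hν _ _) (integrable_Si hν _ _), smoothedCdf, smoothedCdf]
    ring
  rw [e1, ← integral_complex_ofReal]
  simp_rw [Si_increment hh]
  rw [← intervalIntegral_integral_swap, intervalIntegral.integral_of_le (by linarith),
    ← integral_Icc_eq_integral_Ioc, ← integral_indicator measurableSet_Icc]
  · refine integral_congr_ae (Eventually.of_forall fun w => ?_)
    by_cases hw : w ∈ Set.Icc (-(1 / (2 * Real.pi * h))) (1 / (2 * Real.pi * h))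
    · simp only [Set.indicator_of_mem hw, stieltjesFourier, ← integral_const_mul]
      simp_rw [mul_comm]
    · simp only [Set.indicator_of_notMem hw, mul_zero]
  · have : IsFiniteMeasure ((volume : Measure ℝ).restrict
        (Set.uIoc (-(1 / (2 * Real.pi * h))) (1 / (2 * Real.pi * h)))) := ⟨by simp [Set.uIoc]⟩
    refine Integrable.mono' (g := fun _ => |b - a|) (integrable_const _) ?_
      (Eventually.of_forall fun p => ?_)
    · have := continuous_intervalTransform a b
      exact Continuous.aestronglyMeasurable (by unfold Function.uncurry; fun_prop)
    · simp only [Function.uncurry, norm_mul, Complex.norm_exp_ofReal_mul_I, one_mul]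
      exact norm_intervalTransform_le _ _ _

/-- The symmetrized smoothed distribution function has total limit `1`, since `Si` is odd and slowly
varying; no limit of `Si` itself is used. -/
lemma tendsto_smoothedCdf_add (hν : Integrable (fun y => |y|) ν) {h : ℝ} (hh : 0 < h) :
    Tendsto (fun x => smoothedCdf ν h x + smoothedCdf ν h (-x)) atTop (𝓝 1) := by
  have e : ∀ x, smoothedCdf ν h x + smoothedCdf ν h (-x)
      = 1 + ∫ y, (Si (x / h - y / h) - Si (x / h + y / h)) ∂ν := fun x => by
    have h2 : ∀ y, Si ((-x - y) / h) = - Si (x / h + y / h) := fun y => by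
      rw [← Si_neg]; congr 1; ring
    have h3 := integrable_Si hν h (-x)
    simp_rw [h2] at h3
    rw [integral_sub (by simpa only [sub_div] using integrable_Si hν h x) (by simpa using h3.neg),
      smoothedCdf, smoothedCdf]
    simp_rw [h2, sub_div, integral_neg]
    ring
  simp_rw [e]
  have key : Tendsto (fun x => ∫ y, (Si (x / h - y / h) - Si (x / h + y / h)) ∂ν) atTop
      (𝓝 (∫ _, (0 : ℝ) ∂ν)) := by
    refine tendsto_integral_filter_of_dominated_convergence (fun y => 2 * |y| / h) ?_ ?_
      ((hν.const_mul 2).div_const h) ?_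
    · refine Eventually.of_forall fun x => Continuous.aestronglyMeasurable ?_
      have := continuous_Si
      fun_prop
    · refine Eventually.of_forall fun x => Eventually.of_forall fun y => ?_
      refine (abs_Si_sub_le _ _).trans_eq ?_
      rw [show x / h - y / h - (x / h + y / h) = -(2 * y / h) by ring, abs_neg, abs_div, abs_mul,
        abs_two, abs_of_pos hh]
    · exact Eventually.of_forall fun y =>
        (tendsto_Si_sub_Si (y / h)).comp (tendsto_id.atTop_div_const hh)
  simpa using key.const_add 1

end Smoothed

section Key

open FourierTransform

variable {ν : Measure ℝ} [IsProbabilityMeasure ν] {f : ℝ → ℝ}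
  [IsProbabilityMeasure (densityLaw f)]

/-- The smoothing error of distribution functions is an inverse Fourier transform. Both sides have
the same increments, and both sides, symmetrized, vanish at infinity. -/
lemma smoothedCdf_sub_distFun (hf_meas : Measurable f) (hf_nonneg : ∀ x, 0 ≤ f x)
    (hf_sq : MemLp f 2 volume) (hf_mean : Integrable (fun x : ℝ => |x| * f x) volume)
    (hν : Integrable (fun y => |y|) ν) {h : ℝ} (hh : 0 < h) (x : ℝ) :
    ((smoothedCdf ν h x - distFun f x : ℝ) : ℂ)
      = 𝓕⁻ (errorTransform ν (densityLaw f) (1 / (2 * Real.pi * h))) x := by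
  have hpi := Real.pi_pos
  set W : ℝ := 1 / (2 * Real.pi * h) with hWdef
  have hW : 0 < W := by positivity
  have hμ := integrable_abs_densityLaw hf_meas hf_nonneg hf_mean
  have hψ := memLp_stieltjesFourier_densityLaw hf_meas hf_nonneg hf_sq
  set G := errorTransform ν (densityLaw f) W with hG
  have hGi : Integrable G := integrable_errorTransform hν hμ hψ hW
  set S : ℝ → ℝ := fun x => smoothedCdf ν h x - distFun f x with hS
  have hu : ∀ x, 𝓕⁻ G x = ∫ w, Complex.exp ((2 * Real.pi * x * w : ℝ) * Complex.I) * G w :=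
    fun x => by
      rw [Real.fourierInv_eq']
      refine integral_congr_ae (Eventually.of_forall fun w => ?_)
      simp only [smul_eq_mul, RCLike.inner_apply, conj_trivial, mul_assoc]
  have hint : ∀ x : ℝ, Integrable
      (fun w => Complex.exp ((2 * Real.pi * x * w : ℝ) * Complex.I) * G w) := fun x =>
    hGi.bdd_mul (c := 1) (Continuous.aestronglyMeasurable (by fun_prop))
      (Eventually.of_forall fun w => (Complex.norm_exp_ofReal_mul_I _).le)
  have hE1 : ∀ a b, Integrable (fun w => intervalTransform a b w *
      (Set.Icc (-W) W).indicator (stieltjesFourier ν) w) := fun a b =>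
    ((integrable_indicator_iff measurableSet_Icc).2
      ((continuous_stieltjesFourier ν).continuousOn.integrableOn_compact isCompact_Icc)).bdd_mul
      (c := |b - a|) (continuous_intervalTransform a b).aestronglyMeasurable
      (Eventually.of_forall fun w => norm_intervalTransform_le a b w)
  have hinc : ∀ a b, a ≤ b → ((S b : ℝ) : ℂ) - (S a : ℝ) = 𝓕⁻ G b - 𝓕⁻ G a := by
    intro a b hab
    rw [hu, hu, ← integral_sub (hint b) (hint a)]
    -- multiplication of `G` by `2πiw` removes the denominator, except at `w = 0`
    have e0 : (∫ w, (Complex.exp ((2 * Real.pi * b * w : ℝ) * Complex.I) * G w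
          - Complex.exp ((2 * Real.pi * a * w : ℝ) * Complex.I) * G w))
        = ∫ w, (intervalTransform a b w * (Set.Icc (-W) W).indicator (stieltjesFourier ν) w
          - intervalTransform a b w * stieltjesFourier (densityLaw f) w) := by
      refine integral_congr_ae ?_
      filter_upwards [compl_mem_ae_iff.2 (measure_singleton (0 : ℝ))] with w hw
      have hw0 : (w : ℂ) ≠ 0 := by simpa using hw
      have hp : (Real.pi : ℂ) ≠ 0 := by simp
      have hc : (2 * Real.pi * w * Complex.I : ℂ) ≠ 0 := by simp [hp, hw0]
      rw [← sub_mul, ← mul_intervalTransform, ← mul_sub, hG, errorTransform,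
        mul_div_assoc', div_eq_iff hc]
      ring
    have hE2 : Integrable (fun w => intervalTransform a b w *
        stieltjesFourier (densityLaw f) w) := by
      have hI : Integrable (fun w => intervalTransform a b w *
          (2 * Real.pi * w * Complex.I * G w)) := by
        refine ((hint b).sub (hint a)).congr (Eventually.of_forall fun w => ?_)
        simp only [Pi.sub_apply]
        rw [← sub_mul, ← mul_intervalTransform]
        ring
      refine ((hE1 a b).sub hI).congr ?_
      filter_upwards [compl_mem_ae_iff.2 (measure_singleton (0 : ℝ))] with w hw
      have hw0 : (w : ℂ) ≠ 0 := by simpa using hw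
      have hp : (Real.pi : ℂ) ≠ 0 := by simp
      have hc : (2 * Real.pi * w * Complex.I : ℂ) ≠ 0 := by simp [hp, hw0]
      simp only [Pi.sub_apply]
      rw [hG, errorTransform, mul_div_cancel₀ _ hc]
      ring
    rw [e0, integral_sub (hE1 a b) hE2, integral_intervalTransform_mul hf_meas hf_nonneg hf_sq hab,
      hWdef, integral_intervalTransform_indicator hh hν]
    simp only [hS]
    push_cast
    ring
  have hconst : ∀ y, ((S y : ℝ) : ℂ) - 𝓕⁻ G y = (S x : ℝ) - 𝓕⁻ G x := fun y => by
    rcases le_total x y with hxy | hxy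
    · linear_combination hinc x y hxy
    · linear_combination -hinc y x hxy
  -- the difference is a constant; its values at `y` and `-y` have a sum that tends to zero
  have hlim : Tendsto (fun y : ℝ => (((S y : ℝ) : ℂ) - 𝓕⁻ G y) + ((S (-y) : ℝ) - 𝓕⁻ G (-y)))
      atTop (𝓝 0) := by
    have hF : (cdf (densityLaw f) : ℝ → ℝ) = distFun f :=
      funext fun y => (distFun_eq_cdf hf_meas hf_nonneg y).symm
    have t1 : Tendsto (fun y => S y + S (-y)) atTop (𝓝 0) := by
      have h1 := tendsto_smoothedCdf_add hν hh
      have h2 : Tendsto (distFun f) atTop (𝓝 1) := 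
          hF ▸ tendsto_cdf_atTop (densityLaw f)
      have h3 : Tendsto (fun y => distFun f (-y)) atTop (𝓝 0) := by
        have : Tendsto (distFun f) atBot (𝓝 0) := 
          hF ▸ tendsto_cdf_atBot (densityLaw f)
        exact this.comp tendsto_neg_atTop_atBot
      have h4 := h1.sub (h2.add h3)
      rw [add_zero, sub_self] at h4
      refine h4.congr fun y => ?_
      simp only [hS]
      ring
    have t2 : Tendsto (fun y : ℝ => 𝓕⁻ G y) (cocompact ℝ) (𝓝 0) := by
      simp_rw [Real.fourierInv_eq_fourier_comp_neg]
      exact Real.zero_at_infty_fourier _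
    have t3 := t2.mono_left atTop_le_cocompact
    have t4 := (t2.mono_left atBot_le_cocompact).comp tendsto_neg_atTop_atBot
    have t5 := ((Complex.continuous_ofReal.tendsto 0).comp t1).sub (t3.add t4)
    simp only [Complex.ofReal_zero, add_zero, sub_self] at t5
    refine t5.congr fun y => ?_
    simp only [Function.comp]
    push_cast
    ring
  simp_rw [hconst] at hlim
  have h0 := tendsto_nhds_unique hlim tendsto_const_nhds
  have h1 : (S x : ℂ) - 𝓕⁻ G x = 0 := by linear_combination -(1 / 2 : ℂ) * h0
  exact sub_eq_zero.1 h1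

/-- Parseval's identity for the error of a distribution function smoothed by the sinc kernel. -/
lemma lintegral_sq_smoothedCdf_sub (hf_meas : Measurable f) (hf_nonneg : ∀ x, 0 ≤ f x)
    (hf_sq : MemLp f 2 volume) (hf_mean : Integrable (fun x : ℝ => |x| * f x) volume)
    (hν : Integrable (fun y => |y|) ν) {h : ℝ} (hh : 0 < h) :
    ∫⁻ x, ENNReal.ofReal ((smoothedCdf ν h x - distFun f x) ^ 2)
      = ∫⁻ w, ‖errorTransform ν (densityLaw f) (1 / (2 * Real.pi * h)) w‖ₑ ^ 2 := by
  have hpi := Real.pi_pos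
  have hW : 0 < 1 / (2 * Real.pi * h) := by positivity
  have hμ := integrable_abs_densityLaw hf_meas hf_nonneg hf_mean
  have hψ := memLp_stieltjesFourier_densityLaw hf_meas hf_nonneg hf_sq
  rw [← lintegral_enorm_sq_fourier (integrable_errorTransform hν hμ hψ hW)
    (memLp_errorTransform hν hμ hψ hW), ← lintegral_neg_eq_self]
  refine lintegral_congr fun x => ?_
  have key := smoothedCdf_sub_distFun hf_meas hf_nonneg hf_sq hf_mean hν hh (-x)
  rw [Real.fourierInv_eq_fourier_neg, neg_neg] at key
  rw [← key, ← sq_abs, ENNReal.ofReal_pow (abs_nonneg _), ← ofReal_norm, Complex.norm_real,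
    Real.norm_eq_abs]

end Key

/-! ### Mean integrated squared error and squared bias in the frequency domain -/

section Empirical

/-- The empirical distribution of the first `n` values of the sequence `s`. -/
def empiricalLaw (n : ℕ) (s : ℕ → ℝ) : Measure ℝ :=
  (n : ℝ≥0∞)⁻¹ • ∑ j ∈ Finset.range n, Measure.dirac (s j)

lemma isProbabilityMeasure_empiricalLaw {n : ℕ} (hn : 1 ≤ n) (s : ℕ → ℝ) :
    IsProbabilityMeasure (empiricalLaw n s) := by
  refine ⟨?_⟩
  simp only [empiricalLaw, Measure.smul_apply, Measure.finsetSum_apply, measure_univ,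
    Finset.sum_const, Finset.card_range, smul_eq_mul, nsmul_eq_mul, mul_one]
  exact ENNReal.inv_mul_cancel (by simp; omega) (by simp)

lemma integral_empiricalLaw {E : Type*} [NormedAddCommGroup E] [NormedSpace ℝ E] [CompleteSpace E]
    (n : ℕ) (s : ℕ → ℝ) (g : ℝ → E) :
    ∫ y, g y ∂(empiricalLaw n s) = (n : ℝ)⁻¹ • ∑ j ∈ Finset.range n, g (s j) := by
  rw [empiricalLaw, integral_smul_measure, integral_finsetSum_measure]
  · simp
  · exact fun j _ => integrable_dirac (by simp)

lemma integrable_empiricalLaw {n : ℕ} (hn : 1 ≤ n) (s : ℕ → ℝ) (g : ℝ → ℝ) :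
    Integrable g (empiricalLaw n s) := by
  refine Integrable.smul_measure ?_ (by simp; omega)
  exact integrable_finsetSum_measure.2 fun j _ => integrable_dirac (by simp)

lemma estimator_eq_smoothedCdf (n : ℕ) {h : ℝ} (hh : 0 < h) (s : ℕ → ℝ) (x : ℝ) :
    estimator n h s x = smoothedCdf (empiricalLaw n s) h x := by
  rw [estimator, if_neg hh.ne', smoothedCdf, integral_empiricalLaw, smul_eq_mul]

end Empirical

section Variance

variable {Ω : Type*} [MeasurableSpace Ω] {P : Measure Ω} [IsProbabilityMeasure P]
  {X : ℕ → Ω → ℝ} {μ : Measure ℝ}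

lemma integral_sq_average_sub (hX_indep : iIndepFun X P) (hX_law : ∀ j, HasLaw (X j) μ P)
    {n : ℕ} (hn : 1 ≤ n) {g : ℝ → ℝ} (hg : Measurable g) (hgb : ∀ y, |g y| ≤ 1) :
    ∫ ω, ((n : ℝ)⁻¹ * ∑ j ∈ Finset.range n, g (X j ω) - ∫ y, g y ∂μ) ^ 2 ∂P
      = (n : ℝ)⁻¹ * (∫ y, g y ^ 2 ∂μ - (∫ y, g y ∂μ) ^ 2) := by
  have hXm : ∀ j, AEMeasurable (X j) P := fun j => (hX_law j).aemeasurable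
  have hgX : ∀ j, AEMeasurable (fun ω => g (X j ω)) P := fun j => hg.comp_aemeasurable (hXm j)
  have hL : ∀ j, MemLp (fun ω => g (X j ω)) 2 P := fun j =>
    MemLp.of_bound (hgX j).aestronglyMeasurable 1 (Eventually.of_forall fun ω => hgb _)
  have hn0 : (n : ℝ) ≠ 0 := by positivity
  have hmean : ∀ j, ∫ ω, g (X j ω) ∂P = ∫ y, g y ∂μ := fun j =>
    (hX_law j).integral_comp hg.aestronglyMeasurable
  have hmean2 : ∀ j, ∫ ω, g (X j ω) ^ 2 ∂P = ∫ y, g y ^ 2 ∂μ := fun j =>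
    (hX_law j).integral_comp (f := fun y => g y ^ 2) (hg.pow_const 2).aestronglyMeasurable
  have hA : AEMeasurable (fun ω => (n : ℝ)⁻¹ * ∑ j ∈ Finset.range n, g (X j ω)) P :=
    (Finset.aemeasurable_fun_sum _ fun j _ => hgX j).const_mul _
  have hEA : ∫ ω, (n : ℝ)⁻¹ * ∑ j ∈ Finset.range n, g (X j ω) ∂P = ∫ y, g y ∂μ := by
    rw [integral_const_mul, integral_finsetSum _ fun j _ => (hL j).integrable one_le_two]
    simp_rw [hmean]
    rw [Finset.sum_const, Finset.card_range, nsmul_eq_mul, inv_mul_cancel_left₀ hn0]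
  have h1 := variance_eq_integral hA
  rw [hEA] at h1
  rw [← h1, variance_const_mul]
  have h2 := IndepFun.variance_sum (s := Finset.range n) (fun j _ => hL j) (μ := P)
    fun i _ j _ hij => (hX_indep.indepFun hij).comp hg hg
  have e : (∑ j ∈ Finset.range n, fun ω => g (X j ω))
      = fun ω => ∑ j ∈ Finset.range n, g (X j ω) := by
    ext ω; simp
  rw [e] at h2
  rw [h2]
  have h3 : ∀ j, variance (fun ω => g (X j ω)) P
      = ∫ y, g y ^ 2 ∂μ - (∫ y, g y ∂μ) ^ 2 := fun j => by
    rw [variance_eq_sub (hL j), hmean]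
    congr 1
    exact hmean2 j
  simp_rw [h3]
  rw [Finset.sum_const, Finset.card_range, nsmul_eq_mul]
  field_simp

lemma stieltjesFourier_empiricalLaw (n : ℕ) (s : ℕ → ℝ) (w : ℝ) :
    stieltjesFourier (empiricalLaw n s) w
      = (n : ℝ)⁻¹ • ∑ j ∈ Finset.range n,
        Complex.exp ((-(2 * Real.pi * w) * s j : ℝ) * Complex.I) :=
  integral_empiricalLaw _ _ _

variable [IsProbabilityMeasure μ]

lemma stieltjesFourier_re (w : ℝ) :
    (stieltjesFourier μ w).re = ∫ y, Real.cos (-(2 * Real.pi * w) * y) ∂μ := by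
  rw [stieltjesFourier, ← RCLike.re_eq_complex_re,
    ← integral_re (integrable_exp_ofReal_mul_I (by fun_prop))]
  simp only [RCLike.re_eq_complex_re, Complex.exp_ofReal_mul_I_re]

lemma stieltjesFourier_im (w : ℝ) :
    (stieltjesFourier μ w).im = ∫ y, Real.sin (-(2 * Real.pi * w) * y) ∂μ := by
  rw [stieltjesFourier, ← RCLike.im_eq_complex_im,
    ← integral_im (integrable_exp_ofReal_mul_I (by fun_prop))]
  simp only [RCLike.im_eq_complex_im, Complex.exp_ofReal_mul_I_im]

/-- The variance of the empirical characteristic function. -/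
lemma integral_norm_sq_stieltjesFourier_sub (hX_indep : iIndepFun X P)
    (hX_law : ∀ j, HasLaw (X j) μ P) {n : ℕ} (hn : 1 ≤ n) (w : ℝ) :
    ∫ ω, ‖stieltjesFourier (empiricalLaw n fun j => X j ω) w - stieltjesFourier μ w‖ ^ 2 ∂P
      = (1 - ‖stieltjesFourier μ w‖ ^ 2) / n := by
  set θ : ℝ := -(2 * Real.pi * w) with hθ
  have hXm : ∀ j, AEMeasurable (X j) P := fun j => (hX_law j).aemeasurable
  have hcm : Measurable fun y : ℝ => Real.cos (θ * y) := by fun_prop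
  have hsm : Measurable fun y : ℝ => Real.sin (θ * y) := by fun_prop
  have hc := integral_sq_average_sub hX_indep hX_law hn hcm fun y => Real.abs_cos_le_one _
  have hs := integral_sq_average_sub hX_indep hX_law hn hsm fun y => Real.abs_sin_le_one _
  have hint : ∀ g : ℝ → ℝ, Measurable g → (∀ y, |g y| ≤ 1) →
      Integrable (fun ω => ((n : ℝ)⁻¹ * ∑ j ∈ Finset.range n, g (X j ω) - ∫ y, g y ∂μ) ^ 2) P := by
    intro g hg hgb
    have h1 : ∀ j, MemLp (fun ω => g (X j ω)) 2 P := fun j =>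
      MemLp.of_bound (hg.comp_aemeasurable (hXm j)).aestronglyMeasurable 1
        (Eventually.of_forall fun ω => hgb _)
    have h2 : MemLp (fun ω => ∑ j ∈ Finset.range n, g (X j ω)) 2 P :=
      memLp_finsetSum _ fun j _ => h1 j
    exact ((h2.const_mul (n : ℝ)⁻¹).sub (memLp_const (∫ y, g y ∂μ))).integrable_sq
  have e : ∀ ω, ‖stieltjesFourier (empiricalLaw n fun j => X j ω) w - stieltjesFourier μ w‖ ^ 2
      = ((n : ℝ)⁻¹ * ∑ j ∈ Finset.range n, Real.cos (θ * X j ω) - ∫ y, Real.cos (θ * y) ∂μ) ^ 2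
      + ((n : ℝ)⁻¹ * ∑ j ∈ Finset.range n, Real.sin (θ * X j ω) -
          ∫ y, Real.sin (θ * y) ∂μ) ^ 2 := by
    intro ω
    rw [← Complex.normSq_eq_norm_sq, Complex.normSq_apply, Complex.sub_re, Complex.sub_im,
      stieltjesFourier_empiricalLaw, Complex.smul_re, Complex.smul_im, Complex.re_sum,
      Complex.im_sum, stieltjesFourier_re, stieltjesFourier_im]
    simp only [Complex.exp_ofReal_mul_I_re, Complex.exp_ofReal_mul_I_im, smul_eq_mul]
    ring
  simp_rw [e]
  rw [integral_add (hint _ hcm fun y => Real.abs_cos_le_one _)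
    (hint _ hsm fun y => Real.abs_sin_le_one _), hc, hs]
  have h1 : ∫ y, Real.cos (θ * y) ^ 2 ∂μ + ∫ y, Real.sin (θ * y) ^ 2 ∂μ = 1 := by
    have hb : ∀ g : ℝ → ℝ, Measurable g → (∀ y, |g y| ≤ 1) → Integrable (fun y => g y ^ 2) μ :=
      fun g hg hgb => (MemLp.of_bound hg.aestronglyMeasurable 1
        (Eventually.of_forall fun y => hgb y)).integrable_sq
    rw [← integral_add (hb _ hcm fun y => Real.abs_cos_le_one _)
      (hb _ hsm fun y => Real.abs_sin_le_one _)]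
    simp
  rw [← Complex.normSq_eq_norm_sq, Complex.normSq_apply, stieltjesFourier_re, stieltjesFourier_im,
    ← hθ]
  linear_combination (n : ℝ)⁻¹ * h1

end Variance

section Risk

/-- The variance contribution `(1 - |ψ(w)|²) / (2πw)²` to the mean integrated squared error of a
single observation at the frequency `w`. -/
def varianceDensity (μ : Measure ℝ) (w : ℝ) : ℝ :=
  (1 - ‖stieltjesFourier μ w‖ ^ 2) / (2 * Real.pi * |w|) ^ 2

/-- The squared bias `|ψ(w)|² / (2πw)²` caused by discarding the frequency `w`. -/
def biasDensity (μ : Measure ℝ) (w : ℝ) : ℝ :=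
  ‖stieltjesFourier μ w‖ ^ 2 / (2 * Real.pi * |w|) ^ 2

lemma varianceDensity_nonneg (μ : Measure ℝ) [IsProbabilityMeasure μ] (w : ℝ) :
    0 ≤ varianceDensity μ w :=
  div_nonneg (sub_nonneg.2 (pow_le_one₀ (norm_nonneg _) (norm_stieltjesFourier_le μ w)))
    (sq_nonneg _)

lemma biasDensity_nonneg (μ : Measure ℝ) (w : ℝ) : 0 ≤ biasDensity μ w :=
  div_nonneg (sq_nonneg _) (sq_nonneg _)

lemma aemeasurable_errorTransform {Ω : Type*} [MeasurableSpace Ω] {P : Measure Ω}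
    {X : ℕ → Ω → ℝ} (hX : ∀ j, AEMeasurable (X j) P) (n : ℕ) (μ : Measure ℝ)
    [IsProbabilityMeasure μ] (W : ℝ) :
    AEMeasurable (Function.uncurry fun ω w =>
      ‖errorTransform (empiricalLaw n fun j => X j ω) μ W w‖ₑ ^ 2) (P.prod volume) := by
  have h2 := (continuous_stieltjesFourier μ).measurable
  have h1 : AEMeasurable (fun p : Ω × ℝ => (n : ℝ)⁻¹ • ∑ j ∈ Finset.range n,
      Complex.exp ((-(2 * Real.pi * p.2) * X j p.1 : ℝ) * Complex.I)) (P.prod volume) := by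
    refine AEMeasurable.const_smul (Finset.aemeasurable_fun_sum (Finset.range n)
      fun j _ => ?_) ((n : ℝ)⁻¹)
    refine Complex.measurable_exp.comp_aemeasurable
      ((Complex.measurable_ofReal.comp_aemeasurable ?_).mul_const _)
    exact (by fun_prop : Measurable fun p : Ω × ℝ => -(2 * Real.pi * p.2)).aemeasurable.mul
      (hX j).comp_fst
  have h3 : MeasurableSet {p : Ω × ℝ | p.2 ∈ Set.Icc (-W) W} := measurable_snd measurableSet_Icc
  have h4 : (Function.uncurry fun ω w =>
      ‖errorTransform (empiricalLaw n fun j => X j ω) μ W w‖ₑ ^ 2)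
      = fun p : Ω × ℝ => ‖({p : Ω × ℝ | p.2 ∈ Set.Icc (-W) W}.indicator
          (fun p : Ω × ℝ => (n : ℝ)⁻¹ • ∑ j ∈ Finset.range n,
            Complex.exp ((-(2 * Real.pi * p.2) * X j p.1 : ℝ) * Complex.I)) p
          - stieltjesFourier μ p.2) / (2 * Real.pi * p.2 * Complex.I)‖ₑ ^ 2 := by
    ext ⟨ω, w⟩
    simp only [Function.uncurry, errorTransform]
    by_cases hw : w ∈ Set.Icc (-W) W
    · rw [Set.indicator_of_mem hw, Set.indicator_of_mem (by exact hw),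
        stieltjesFourier_empiricalLaw]
    · rw [Set.indicator_of_notMem hw, Set.indicator_of_notMem (by exact hw)]
  rw [h4]
  refine (AEMeasurable.enorm ?_).pow_const 2
  exact ((h1.indicator h3).sub (h2.comp measurable_snd).aemeasurable).div (by fun_prop)

variable {Ω : Type*} [MeasurableSpace Ω] {P : Measure Ω} [IsProbabilityMeasure P]
  {X : ℕ → Ω → ℝ} {f : ℝ → ℝ} [IsProbabilityMeasure (densityLaw f)]

/-- The mean integrated squared error in the frequency domain. -/
lemma MISE_eq (hf_meas : Measurable f) (hf_nonneg : ∀ x, 0 ≤ f x) (hX_indep : iIndepFun X P)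
    (hX_law : ∀ j, HasLaw (X j) (densityLaw f) P) (hf_sq : MemLp f 2 volume)
    (hf_mean : Integrable (fun x : ℝ => |x| * f x) volume) {n : ℕ} (hn : 1 ≤ n) {h : ℝ}
    (hh : 0 < h) :
    MISE P X f n h = ∫⁻ w, ENNReal.ofReal (if |w| ≤ 1 / (2 * Real.pi * h)
      then varianceDensity (densityLaw f) w / n else biasDensity (densityLaw f) w) := by
  have hXm : ∀ j, AEMeasurable (X j) P := fun j => (hX_law j).aemeasurable
  have e : ∀ ω, (∫⁻ x : ℝ, ENNReal.ofReal
      ((estimator n h (fun j => X j ω) x - distFun f x) ^ 2))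
      = ∫⁻ w, ‖errorTransform (empiricalLaw n fun j => X j ω) (densityLaw f)
        (1 / (2 * Real.pi * h)) w‖ₑ ^ 2 := fun ω => by
    have := isProbabilityMeasure_empiricalLaw hn fun j => X j ω
    simp_rw [estimator_eq_smoothedCdf n hh]
    exact lintegral_sq_smoothedCdf_sub hf_meas hf_nonneg hf_sq hf_mean
      (integrable_empiricalLaw hn _ _) hh
  rw [MISE]
  simp_rw [e]
  rw [lintegral_lintegral_swap (aemeasurable_errorTransform hXm n _ _)]
  refine lintegral_congr fun w => ?_
  simp_rw [← ofReal_norm, ← ENNReal.ofReal_pow (norm_nonneg _)]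
  by_cases hw : |w| ≤ 1 / (2 * Real.pi * h)
  · have hw' : w ∈ Set.Icc (-(1 / (2 * Real.pi * h))) (1 / (2 * Real.pi * h)) := abs_le.1 hw
    rw [if_pos hw]
    have hc : ‖(2 * Real.pi * w * Complex.I : ℂ)‖ = 2 * Real.pi * |w| := by
      simp [abs_of_pos Real.pi_pos]
    have e2 : ∀ ω, ‖errorTransform (empiricalLaw n fun j => X j ω) (densityLaw f)
        (1 / (2 * Real.pi * h)) w‖ ^ 2
        = ‖stieltjesFourier (empiricalLaw n fun j => X j ω) w
            - stieltjesFourier (densityLaw f) w‖ ^ 2 / (2 * Real.pi * |w|) ^ 2 := fun ω => by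
      rw [errorTransform, Set.indicator_of_mem hw', norm_div, hc, div_pow]
    simp_rw [e2]
    rw [← ofReal_integral_eq_lintegral_ofReal, integral_div,
      integral_norm_sq_stieltjesFourier_sub hX_indep hX_law hn, varianceDensity, div_right_comm]
    · refine Integrable.div_const (Integrable.mono' (integrable_const (4 : ℝ)) ?_
        (Eventually.of_forall fun ω => ?_)) _
      · simp_rw [stieltjesFourier_empiricalLaw]
        refine AEMeasurable.aestronglyMeasurable ?_
        refine ((AEMeasurable.sub_const (AEMeasurable.const_smul (Finset.aemeasurable_fun_sum
          (Finset.range n) fun j _ => ?_) ((n : ℝ)⁻¹)) _).norm).pow_const 2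
        exact Complex.measurable_exp.comp_aemeasurable
          ((Complex.measurable_ofReal.comp_aemeasurable ((hXm j).const_mul _)).mul_const _)
      · have := isProbabilityMeasure_empiricalLaw hn fun j => X j ω
        rw [Real.norm_of_nonneg (sq_nonneg _)]
        have h1 := norm_sub_le (stieltjesFourier (empiricalLaw n fun j => X j ω) w)
          (stieltjesFourier (densityLaw f) w)
        have h2 := norm_stieltjesFourier_le (empiricalLaw n fun j => X j ω) w
        have h3 := norm_stieltjesFourier_le (densityLaw f) w
        nlinarith [norm_nonneg (stieltjesFourier (empiricalLaw n fun j => X j ω) w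
          - stieltjesFourier (densityLaw f) w)]
    · exact Eventually.of_forall fun ω => by positivity
  · have hw' : w ∉ Set.Icc (-(1 / (2 * Real.pi * h))) (1 / (2 * Real.pi * h)) :=
      fun hc => hw (abs_le.2 hc)
    rw [if_neg hw]
    simp_rw [norm_errorTransform_of_notMem hw', div_pow]
    simp [biasDensity]

/-- The integrated squared bias in the frequency domain. -/
lemma ISB_eq (hf_meas : Measurable f) (hf_nonneg : ∀ x, 0 ≤ f x)
    (hX_law : ∀ j, HasLaw (X j) (densityLaw f) P) (hf_sq : MemLp f 2 volume)
    (hf_mean : Integrable (fun x : ℝ => |x| * f x) volume) {n : ℕ} (hn : 1 ≤ n) {h : ℝ}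
    (hh : 0 < h) :
    ISB P X f n h = ∫⁻ w, ENNReal.ofReal (if |w| ≤ 1 / (2 * Real.pi * h)
      then 0 else biasDensity (densityLaw f) w) := by
  have hμ := integrable_abs_densityLaw hf_meas hf_nonneg hf_mean
  have hn0 : (n : ℝ) ≠ 0 := by positivity
  have e : ∀ x, ∫ ω, estimator n h (fun j => X j ω) x ∂P = smoothedCdf (densityLaw f) h x := by
    intro x
    have hS : Continuous fun y => Si ((x - y) / h) := continuous_Si.comp (by fun_prop)
    have hi : ∀ j, Integrable (fun ω => Si ((x - X j ω) / h)) P := fun j => by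
      have h1 := integrable_Si hμ h x
      rw [← (hX_law j).map_eq] at h1
      exact h1.comp_aemeasurable (hX_law j).aemeasurable
    simp only [estimator, if_neg hh.ne']
    rw [integral_add (integrable_const _) ((integrable_finsetSum _ fun j _ => hi j).const_mul _),
      integral_const_mul, integral_finsetSum _ fun j _ => hi j]
    have : ∀ j, ∫ ω, Si ((x - X j ω) / h) ∂P = ∫ y, Si ((x - y) / h) ∂(densityLaw f) := fun j =>
      (hX_law j).integral_comp hS.aestronglyMeasurable
    simp_rw [this]
    rw [Finset.sum_const, Finset.card_range, nsmul_eq_mul, inv_mul_cancel_left₀ hn0, smoothedCdf]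
    simp
  rw [ISB]
  simp_rw [e]
  rw [lintegral_sq_smoothedCdf_sub hf_meas hf_nonneg hf_sq hf_mean hμ hh]
  refine lintegral_congr fun w => ?_
  simp_rw [← ofReal_norm, ← ENNReal.ofReal_pow (norm_nonneg _)]
  by_cases hw : |w| ≤ 1 / (2 * Real.pi * h)
  · have hw' : w ∈ Set.Icc (-(1 / (2 * Real.pi * h))) (1 / (2 * Real.pi * h)) := abs_le.1 hw
    rw [if_pos hw, errorTransform, Set.indicator_of_mem hw']
    simp
  · have hw' : w ∉ Set.Icc (-(1 / (2 * Real.pi * h))) (1 / (2 * Real.pi * h)) :=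
      fun hc => hw (abs_le.2 hc)
    rw [if_neg hw, norm_errorTransform_of_notMem hw', div_pow, biasDensity]

/-- The empirical distribution function is unbiased. -/
lemma ISB_zero (hf_meas : Measurable f) (hf_nonneg : ∀ x, 0 ≤ f x)
    (hX_law : ∀ j, HasLaw (X j) (densityLaw f) P) {n : ℕ} (hn : 1 ≤ n) : ISB P X f n 0 = 0 := by
  have hn0 : (n : ℝ) ≠ 0 := by positivity
  have e : ∀ x, ∫ ω, estimator n 0 (fun j => X j ω) x ∂P = distFun f x := by
    intro x
    have hm : Measurable ((Set.Iic x).indicator (fun _ => (1 : ℝ))) :=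
      measurable_const.indicator measurableSet_Iic
    have e1 : ∀ y : ℝ, (Set.Ici y).indicator (fun _ => (1 : ℝ)) x
        = (Set.Iic x).indicator (fun _ => (1 : ℝ)) y := fun y => by
      simp [Set.indicator_apply]
    simp only [estimator, if_true, e1]
    have hi : ∀ j, Integrable (fun ω => (Set.Iic x).indicator (fun _ => (1 : ℝ)) (X j ω)) P :=
      fun j => (integrable_const (1 : ℝ)).mono'
        (hm.comp_aemeasurable (hX_law j).aemeasurable).aestronglyMeasurable
        (Eventually.of_forall fun ω => by
          simp only [Set.indicator_apply]
          split_ifs <;> simp)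
    have e2 : ∀ j, ∫ ω, (Set.Iic x).indicator (fun _ => (1 : ℝ)) (X j ω) ∂P = distFun f x :=
      fun j => by
        refine ((hX_law j).integral_comp hm.aestronglyMeasurable).trans ?_
        rw [distFun_eq_cdf hf_meas hf_nonneg, cdf_eq_real, integral_indicator_const _
          measurableSet_Iic]
        simp
    rw [integral_const_mul, integral_finsetSum _ fun j _ => hi j]
    simp_rw [e2]
    rw [Finset.sum_const, Finset.card_range, nsmul_eq_mul, inv_mul_cancel_left₀ hn0]
  rw [ISB]
  simp [e]

end Risk

/-! ### The risk as a function of the cutoff frequency -/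

section Densities

variable {μ : Measure ℝ}

lemma norm_stieltjesFourier_abs (w : ℝ) : ‖stieltjesFourier μ |w|‖ = ‖stieltjesFourier μ w‖ := by
  rcases abs_choice w with h | h
  · rw [h]
  · rw [h, ← Complex.norm_conj (stieltjesFourier μ w), stieltjesFourier, stieltjesFourier,
      ← integral_conj]
    congr 2
    ext y
    rw [← Complex.exp_conj, map_mul, Complex.conj_I, Complex.conj_ofReal]
    congr 1
    push_cast
    ring

lemma varianceDensity_abs (w : ℝ) : varianceDensity μ |w| = varianceDensity μ w := by
  simp only [varianceDensity, norm_stieltjesFourier_abs, abs_abs]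

lemma biasDensity_abs (w : ℝ) : biasDensity μ |w| = biasDensity μ w := by
  simp only [biasDensity, norm_stieltjesFourier_abs, abs_abs]

variable [IsProbabilityMeasure μ]

lemma measurable_biasDensity : Measurable (biasDensity μ) := by
  have := (continuous_stieltjesFourier μ).measurable
  unfold biasDensity
  fun_prop

lemma measurable_varianceDensity : Measurable (varianceDensity μ) := by
  have := (continuous_stieltjesFourier μ).measurable
  unfold varianceDensity
  fun_prop

lemma biasDensity_le {W w : ℝ} (hW : 0 < W) (hw : W < |w|) :
    biasDensity μ w ≤ (1 + (W ^ 2)⁻¹) * (1 + w ^ 2)⁻¹ := by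
  have h0 : 0 < |w| := hW.trans hw
  refine le_trans ?_ (inv_sq_abs_le hW hw)
  rw [← one_div, biasDensity]
  refine div_le_div₀ zero_le_one
    (pow_le_one₀ (norm_nonneg _) (norm_stieltjesFourier_le μ w)) (by positivity) ?_
  exact pow_le_pow_left₀ h0.le (by nlinarith [Real.pi_gt_three]) 2

lemma integrableOn_biasDensity {W : ℝ} (hW : 0 < W) :
    IntegrableOn (biasDensity μ) {w | W < |w|} := by
  have hs : MeasurableSet {w : ℝ | W < |w|} := measurableSet_lt measurable_const (by fun_prop)
  refine (integrable_inv_one_add_sq.const_mul (1 + (W ^ 2)⁻¹)).integrableOn.mono'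
    measurable_biasDensity.aestronglyMeasurable ?_
  filter_upwards [ae_restrict_mem hs] with w hw
  rw [Real.norm_of_nonneg (biasDensity_nonneg μ w)]
  exact biasDensity_le hW hw

lemma integrableOn_Ioi_biasDensity {W : ℝ} (hW : 0 < W) :
    IntegrableOn (biasDensity μ) (Set.Ioi W) :=
  (integrableOn_biasDensity hW).mono_set fun w hw =>
    (Set.mem_Ioi.1 hw).trans_le (le_abs_self w)

lemma varianceDensity_le (w : ℝ) :
    varianceDensity μ w
      ≤ ∫ y, 2 * (1 - Real.cos (-(2 * Real.pi * w) * y)) / (2 * Real.pi * |w|) ^ 2 ∂μ := by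
  have hc : Integrable (fun y => Real.cos (-(2 * Real.pi * w) * y)) μ :=
    (integrable_const (1 : ℝ)).mono' (Continuous.aestronglyMeasurable (by fun_prop))
      (Eventually.of_forall fun y => Real.abs_cos_le_one _)
  rw [integral_div, integral_const_mul, integral_sub (integrable_const _) hc,
    ← stieltjesFourier_re, varianceDensity]
  refine div_le_div_of_nonneg_right ?_ (sq_nonneg _)
  have h1 := norm_stieltjesFourier_le μ w
  have h2 := Complex.abs_re_le_norm (stieltjesFourier μ w)
  have h3 : (stieltjesFourier μ w).re ^ 2 ≤ ‖stieltjesFourier μ w‖ ^ 2 := by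
    rw [← sq_abs]
    exact pow_le_pow_left₀ (abs_nonneg _) h2 2
  simp only [integral_const, probReal_univ, smul_eq_mul, mul_one]
  nlinarith [sq_nonneg ((stieltjesFourier μ w).re - 1)]

/-- The kernel that dominates the variance contribution of a single value `y` has an integral
proportional to `|y|`. -/
lemma lintegral_cauchy_kernel (y : ℝ) :
    ∫⁻ w, ENNReal.ofReal (5 * y ^ 2 * (1 + (2 * Real.pi * y * w) ^ 2)⁻¹)
      = ENNReal.ofReal (5 / 2 * |y|) := by
  have hpi := Real.pi_pos
  rcases eq_or_ne y 0 with rfl | hy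
  · simp
  have hc : 2 * Real.pi * y ≠ 0 := by positivity
  rw [← ofReal_integral_eq_lintegral_ofReal
    ((integrable_inv_one_add_sq.comp_mul_left' hc).const_mul _)
    (Eventually.of_forall fun w => by positivity), integral_const_mul,
    Measure.integral_comp_mul_left (fun v : ℝ => (1 + v ^ 2)⁻¹), integral_univ_inv_one_add_sq,
    abs_inv, abs_mul, abs_of_pos (by positivity : 0 < 2 * Real.pi), smul_eq_mul, ← sq_abs y]
  have := abs_pos.2 hy
  congr 1
  field_simp

/-- A finite first moment makes the variance density integrable at the origin. -/
lemma integrable_varianceDensity (hμ : Integrable (fun y => |y|) μ) :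
    Integrable (varianceDensity μ) := by
  refine ⟨measurable_varianceDensity.aestronglyMeasurable, ?_⟩
  rw [hasFiniteIntegral_iff_ofReal (Eventually.of_forall (varianceDensity_nonneg μ))]
  have h1 : ∫⁻ w, ENNReal.ofReal (varianceDensity μ w)
      ≤ ∫⁻ w, ∫⁻ y, ENNReal.ofReal (5 * y ^ 2 * (1 + (2 * Real.pi * y * w) ^ 2)⁻¹) ∂μ := by
    refine lintegral_mono_ae ?_
    filter_upwards [compl_mem_ae_iff.2 (measure_singleton (0 : ℝ))] with w hw
    have hw0 : w ≠ 0 := by simpa using hw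
    -- with `θ = 2πwy`, the integrand bound `(1 - cos θ) (1 + θ²) ≤ 5θ² / 2` is integrable in `w`
    refine (ENNReal.ofReal_le_ofReal (varianceDensity_le w)).trans ?_
    have hd : 0 < 2 * Real.pi * |w| := by have := Real.pi_pos; positivity
    rw [ofReal_integral_eq_lintegral_ofReal]
    · refine lintegral_mono fun y => ENNReal.ofReal_le_ofReal ?_
      have hθ : (2 * Real.pi * y * w) ^ 2 = y ^ 2 * (2 * Real.pi * |w|) ^ 2 := by
        rw [mul_pow (2 * Real.pi) |w|, sq_abs]; ring
      rw [← div_eq_mul_inv, div_le_div_iff₀ (by positivity) (by positivity)]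
      have h3 := Real.one_sub_sq_div_two_le_cos (x := -(2 * Real.pi * w) * y)
      have h4 := Real.neg_one_le_cos (-(2 * Real.pi * w) * y)
      have h5 : (-(2 * Real.pi * w) * y) ^ 2 = (2 * Real.pi * y * w) ^ 2 := by ring
      rw [h5] at h3
      nlinarith [mul_nonneg (by linarith : (0 : ℝ) ≤ 1 + Real.cos (-(2 * Real.pi * w) * y))
        (sq_nonneg (2 * Real.pi * y * w))]
    · refine Integrable.div_const (Integrable.const_mul ?_ 2) _
      refine (integrable_const (2 : ℝ)).mono' (Continuous.aestronglyMeasurable (by fun_prop))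
        (Eventually.of_forall fun y => ?_)
      rw [Real.norm_eq_abs, abs_le]
      constructor <;>
        linarith [Real.neg_one_le_cos (-(2 * Real.pi * w) * y),
          Real.cos_le_one (-(2 * Real.pi * w) * y)]
    · refine Eventually.of_forall fun y => div_nonneg ?_ (sq_nonneg _)
      linarith [Real.cos_le_one (-(2 * Real.pi * w) * y)]
  refine h1.trans_lt ?_
  rw [lintegral_lintegral_swap (Measurable.aemeasurable (by unfold Function.uncurry; fun_prop))]
  simp_rw [lintegral_cauchy_kernel]
  rw [← ofReal_integral_eq_lintegral_ofReal (hμ.const_mul _)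
    (Eventually.of_forall fun y => by positivity)]
  exact ENNReal.ofReal_lt_top

end Densities

section EvenSplit

/-- The integral of an even function that is given by different expressions for low and high
frequencies. -/
lemma lintegral_ofReal_ite_abs {a b : ℝ → ℝ} (ha : ∀ w, a |w| = a w) (hb : ∀ w, b |w| = b w)
    (ha0 : ∀ w, 0 ≤ a w) (hb0 : ∀ w, 0 ≤ b w) {W : ℝ} (hW : 0 < W) (hai : Integrable a)
    (hbi : IntegrableOn b {w | W < |w|}) :
    ∫⁻ w, ENNReal.ofReal (if |w| ≤ W then a w else b w)
      = ENNReal.ofReal (2 * ((∫ w in Set.Ioc 0 W, a w) + ∫ w in Set.Ioi W, b w)) := by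
  have hs : MeasurableSet {w : ℝ | W < |w|} := measurableSet_lt measurable_const (by fun_prop)
  have e0 : (fun w => if |w| ≤ W then a w else b w)
      = fun w => {w : ℝ | W < |w|}ᶜ.indicator a w + {w : ℝ | W < |w|}.indicator b w := by
    ext w
    by_cases hw : |w| ≤ W
    · simp [hw]
    · simp [hw, not_le.1 hw]
  have hi : Integrable (fun w => if |w| ≤ W then a w else b w) := by
    rw [e0]
    exact (hai.indicator hs.compl).add ((integrable_indicator_iff hs).2 hbi)
  rw [← ofReal_integral_eq_lintegral_ofReal hi (Eventually.of_forall fun w => by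
    simp only; split_ifs; exacts [ha0 w, hb0 w])]
  congr 1
  have e1 : (fun w => if |w| ≤ W then a w else b w)
      = fun w => (fun v => if v ≤ W then a v else b v) |w| := by
    ext w
    simp only [ha, hb]
  rw [e1, integral_comp_abs (f := fun v => if v ≤ W then a v else b v)]
  have hi' : IntegrableOn (fun v => if v ≤ W then a v else b v) (Set.Ioi 0) :=
    hi.integrableOn.congr_fun (fun w hw => by
      simp only [abs_of_pos (Set.mem_Ioi.1 hw)]) measurableSet_Ioi
  rw [← Set.Ioc_union_Ioi_eq_Ioi hW.le, setIntegral_union (Set.Ioc_disjoint_Ioi le_rfl)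
    measurableSet_Ioi (hi'.mono_set Set.Ioc_subset_Ioi_self)
    (hi'.mono_set (Set.Ioi_subset_Ioi hW.le))]
  congr 2
  · exact setIntegral_congr_fun measurableSet_Ioc fun w hw => if_pos hw.2
  · exact setIntegral_congr_fun measurableSet_Ioi fun w hw => if_neg (not_le.2 hw)

end EvenSplit

section RiskFunction

/-- The integrated squared bias over the positive frequencies if the frequencies above `W` are
discarded. -/
def biasTail (μ : Measure ℝ) (W : ℝ) : ℝ := ∫ w in Set.Ioi W, biasDensity μ w

/-- Half the mean integrated squared error for `n` observations, as a function of the cutoff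
frequency `W`. -/
def cutoffRisk (μ : Measure ℝ) (n : ℕ) (W : ℝ) : ℝ :=
  (∫ w in Set.Ioc 0 W, varianceDensity μ w / n) + biasTail μ W

variable {μ : Measure ℝ} [IsProbabilityMeasure μ]

omit [IsProbabilityMeasure μ] in
lemma biasTail_nonneg (W : ℝ) : 0 ≤ biasTail μ W :=
  integral_nonneg fun w => biasDensity_nonneg μ w

lemma biasTail_le_cutoffRisk (n : ℕ) (W : ℝ) : biasTail μ W ≤ cutoffRisk μ n W :=
  le_add_of_nonneg_left (integral_nonneg fun w =>
    div_nonneg (varianceDensity_nonneg μ w) (Nat.cast_nonneg n))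

lemma cutoffRisk_nonneg (n : ℕ) (W : ℝ) : 0 ≤ cutoffRisk μ n W :=
  (biasTail_nonneg W).trans (biasTail_le_cutoffRisk n W)

lemma biasTail_eq_add {a b : ℝ} (ha : 0 < a) (hab : a ≤ b) :
    biasTail μ a = (∫ w in Set.Ioc a b, biasDensity μ w) + biasTail μ b := by
  have hi := integrableOn_Ioi_biasDensity (μ := μ) ha
  rw [biasTail, ← Set.Ioc_union_Ioi_eq_Ioi hab, setIntegral_union (Set.Ioc_disjoint_Ioi le_rfl)
    measurableSet_Ioi (hi.mono_set Set.Ioc_subset_Ioi_self)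
    (hi.mono_set (Set.Ioi_subset_Ioi hab)), biasTail]

lemma biasTail_anti {a b : ℝ} (ha : 0 < a) (hab : a ≤ b) : biasTail μ b ≤ biasTail μ a := by
  rw [biasTail_eq_add ha hab]
  exact le_add_of_nonneg_left (integral_nonneg fun w => biasDensity_nonneg μ w)

lemma integrableOn_Ioc_sub (hμ : Integrable (fun y => |y|) μ) (n : ℕ) {a : ℝ} (ha : 0 < a)
    (b : ℝ) : IntegrableOn (fun w => varianceDensity μ w / n - biasDensity μ w) (Set.Ioc a b) :=
  ((integrable_varianceDensity hμ).div_const _).integrableOn.sub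
    ((integrableOn_Ioi_biasDensity ha).mono_set (Set.Ioc_subset_Ioi_self (a := b)))

lemma cutoffRisk_eq_add (hμ : Integrable (fun y => |y|) μ) (n : ℕ) {a b : ℝ} (ha : 0 < a)
    (hab : a ≤ b) : cutoffRisk μ n b
      = cutoffRisk μ n a + ∫ w in Set.Ioc a b, (varianceDensity μ w / n - biasDensity μ w) := by
  have hv := (integrable_varianceDensity hμ).div_const (n : ℝ)
  have hb := (integrableOn_Ioi_biasDensity (μ := μ) ha).mono_set
    (Set.Ioc_subset_Ioi_self (a := b))
  rw [integral_sub hv.integrableOn hb, cutoffRisk, cutoffRisk, biasTail_eq_add ha hab,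
    ← Set.Ioc_union_Ioc_eq_Ioc ha.le hab,
    setIntegral_union (Set.Ioc_disjoint_Ioc_of_le le_rfl) measurableSet_Ioc hv.integrableOn
      hv.integrableOn]
  ring

lemma continuousOn_cutoffRisk (hμ : Integrable (fun y => |y|) μ) (n : ℕ) {a b : ℝ} (ha : 0 < a)
    (hab : a ≤ b) : ContinuousOn (cutoffRisk μ n) (Set.Icc a b) := by
  have h1 : ContinuousOn (fun x => cutoffRisk μ n a
      + ∫ w in a..x, (varianceDensity μ w / n - biasDensity μ w)) (Set.Icc a b) := by
    have := intervalIntegral.continuousOn_primitive_interval (μ := volume)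
      (f := fun w => varianceDensity μ w / n - biasDensity μ w) (a := a) (b := b) (by
        rw [Set.uIcc_of_le hab, integrableOn_Icc_iff_integrableOn_Ioc]
        exact integrableOn_Ioc_sub hμ n ha b)
    rw [Set.uIcc_of_le hab] at this
    exact continuousOn_const.add this
  refine h1.congr fun x hx => ?_
  simp only [cutoffRisk_eq_add hμ n ha hx.1, intervalIntegral.integral_of_le hx.1]

/-- The integrated squared bias explodes as the cutoff frequency tends to zero, since the Fourier
transform of a probability measure is `1` at the origin. -/
lemma exists_le_biasTail : ∃ δ > 0, ∃ c > 0, ∀ W, 0 < W → W ≤ δ → c / W ≤ biasTail μ W := by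
  have hcont : Continuous fun w => ‖stieltjesFourier μ w‖ ^ 2 :=
    (continuous_stieltjesFourier μ).norm.pow 2
  have h0 : (1 / 2 : ℝ) < ‖stieltjesFourier μ 0‖ ^ 2 := by
    rw [stieltjesFourier_zero]; norm_num
  obtain ⟨ε, hε, hball⟩ := Metric.eventually_nhds_iff.1
    (hcont.continuousAt.eventually (lt_mem_nhds h0))
  have hpi := Real.pi_pos
  refine ⟨ε / 3, by positivity, 1 / (32 * Real.pi ^ 2), by positivity, fun W hW hWδ => ?_⟩
  have hW2 : W ≤ 2 * W := by linarith
  -- already the frequencies in `(W, 2W]` contribute an amount of order `1 / W`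
  rw [biasTail_eq_add hW hW2]
  refine le_add_of_le_of_nonneg ?_ (biasTail_nonneg _)
  have hlow : ∀ w ∈ Set.Ioc W (2 * W), 1 / (32 * Real.pi ^ 2) / W ^ 2 ≤ biasDensity μ w := by
    intro w hw
    have hw0 : 0 < w := hW.trans hw.1
    have h1 := hball (y := w) (by
      rw [Real.dist_eq, sub_zero, abs_of_pos hw0]
      linarith [hw.2])
    rw [biasDensity, abs_of_pos hw0]
    calc 1 / (32 * Real.pi ^ 2) / W ^ 2 = 1 / 2 / (2 * Real.pi * (2 * W)) ^ 2 := by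
          field_simp; norm_num
      _ ≤ _ := by
          refine div_le_div₀ (sq_nonneg _) h1.le (by positivity) ?_
          exact pow_le_pow_left₀ (by positivity)
            (mul_le_mul_of_nonneg_left hw.2 (by positivity)) 2
  have h3 := setIntegral_mono_on (μ := volume) (integrableOn_const (by simp))
    ((integrableOn_Ioi_biasDensity (μ := μ) hW).mono_set
      (Set.Ioc_subset_Ioi_self (a := 2 * W))) measurableSet_Ioc hlow
  refine le_trans (le_of_eq ?_) h3
  rw [setIntegral_const, measureReal_def, Real.volume_Ioc, ENNReal.toReal_ofReal (by linarith),
    smul_eq_mul]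
  field_simp
  norm_num

/-- The optimal cutoff frequency lies between a small one, below which the bias is too large, and a
large one, above which the variance grows faster than the bias decreases. -/
lemma exists_cutoffRisk_min (hμ : Integrable (fun y => |y|) μ)
    (hlim : Tendsto (fun w => ‖stieltjesFourier μ w‖) atTop (𝓝 0)) {n : ℕ} (hn : 1 ≤ n) :
    ∃ W > 0, ∀ W' > 0, cutoffRisk μ n W ≤ cutoffRisk μ n W' := by
  have hn0 : (0 : ℝ) < n := by positivity
  -- beyond `W₁` the gain in bias is smaller than the loss in variance
  obtain ⟨W₁, hW₁, hlarge⟩ : ∃ W₁ > 0, ∀ w, W₁ ≤ w →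
      0 ≤ varianceDensity μ w / n - biasDensity μ w := by
    have h2 : Tendsto (fun w => ((n : ℝ) + 1) * ‖stieltjesFourier μ w‖ ^ 2) atTop (𝓝 0) := by
      simpa using (hlim.pow 2).const_mul ((n : ℝ) + 1)
    obtain ⟨a, ha⟩ := eventually_atTop.1 (h2.eventually (gt_mem_nhds one_pos))
    refine ⟨max a 1, by positivity, fun w hw => ?_⟩
    have h3 := ha w ((le_max_left _ _).trans hw)
    rw [varianceDensity, biasDensity, div_right_comm, ← sub_div]
    refine div_nonneg ?_ (sq_nonneg _)
    rw [sub_nonneg, le_div_iff₀ hn0]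
    linarith
  obtain ⟨δ, hδ, c, hc, hsmall⟩ := exists_le_biasTail (μ := μ)
  set q := cutoffRisk μ n W₁ with hq
  have hq0 : 0 ≤ q := cutoffRisk_nonneg n W₁
  set W₀ := min (min δ W₁) (c / (q + 1)) with hW₀
  have hW₀pos : 0 < W₀ := lt_min (lt_min hδ hW₁) (by positivity)
  have hW₀₁ : W₀ ≤ W₁ := (min_le_left _ _).trans (min_le_right _ _)
  obtain ⟨W, hW, hmin⟩ := isCompact_Icc.exists_isMinOn (Set.nonempty_Icc.2 hW₀₁)
    (continuousOn_cutoffRisk hμ n hW₀pos hW₀₁)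
  have hWq : cutoffRisk μ n W ≤ q := hmin (Set.right_mem_Icc.2 hW₀₁)
  refine ⟨W, hW₀pos.trans_le hW.1, fun W' hW' => ?_⟩
  rcases le_total W' W₀ with h | h
  · have h1 := hsmall W' hW' (h.trans ((min_le_left _ _).trans (min_le_left _ _)))
    have h2 : q + 1 ≤ c / W' := by
      rw [le_div_comm₀ (by positivity) hW']
      exact h.trans (min_le_right _ _)
    linarith [biasTail_le_cutoffRisk (μ := μ) n W']
  · rcases le_total W' W₁ with h' | h'
    · exact hmin ⟨h, h'⟩
    · rw [cutoffRisk_eq_add hμ n hW₁ h']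
      have : 0 ≤ ∫ w in Set.Ioc W₁ W', (varianceDensity μ w / n - biasDensity μ w) :=
        setIntegral_nonneg measurableSet_Ioc fun w hw => hlarge w hw.1.le
      linarith

lemma biasTail_pos {W w : ℝ} (hW : 0 < W) (hw : W < w) (hψ : stieltjesFourier μ w ≠ 0) :
    0 < biasTail μ W := by
  rw [biasTail, setIntegral_pos_iff_support_of_nonneg_ae
    (Eventually.of_forall fun w => biasDensity_nonneg μ w) (integrableOn_Ioi_biasDensity hW)]
  have hopen : IsOpen ({w | stieltjesFourier μ w ≠ 0} ∩ Set.Ioi W) :=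
    (isOpen_ne_fun (continuous_stieltjesFourier μ) continuous_const).inter isOpen_Ioi
  refine (hopen.measure_pos volume ⟨w, hψ, hw⟩).trans_le (measure_mono ?_)
  rintro v ⟨hv, hvW⟩
  refine ⟨?_, hvW⟩
  have hv0 : 0 < v := hW.trans hvW
  have hpi := Real.pi_pos
  have hv1 : 0 < ‖stieltjesFourier μ v‖ := norm_pos_iff.2 hv
  rw [Function.mem_support, biasDensity, abs_of_pos hv0]
  positivity

lemma tendsto_biasTail : Tendsto (biasTail μ) atTop (𝓝 0) := by
  have hi := integrableOn_Ioi_biasDensity (μ := μ) one_pos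
  have h1 := intervalIntegral_tendsto_integral_Ioi 1 hi tendsto_id
  have h2 := h1.const_sub (biasTail μ 1)
  rw [← biasTail, sub_self] at h2
  refine h2.congr' ?_
  filter_upwards [eventually_ge_atTop 1] with W hW
  rw [biasTail_eq_add one_pos hW, intervalIntegral.integral_of_le (by exact hW)]
  simp

/-- For large samples, no cutoff frequency that leaves a positive bias is optimal. -/
lemma eventually_lt_of_isMin {W₀ : ℝ}
    (hpos : 0 < biasTail μ W₀) : ∀ᶠ n : ℕ in atTop, ∀ W > 0,
      (∀ W' > 0, cutoffRisk μ n W ≤ cutoffRisk μ n W') → W₀ < W := by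
  obtain ⟨W', hW', hW'pos⟩ := ((tendsto_biasTail (μ := μ)).eventually
    (gt_mem_nhds hpos) |>.and (eventually_gt_atTop 0)).exists
  have hlim : Tendsto (fun n : ℕ => cutoffRisk μ n W') atTop (𝓝 (biasTail μ W')) := by
    have : Tendsto (fun n : ℕ => (∫ w in Set.Ioc 0 W', varianceDensity μ w) / n
        + biasTail μ W') atTop (𝓝 (0 + biasTail μ W')) :=
      (tendsto_const_div_atTop_nhds_zero_nat _).add_const _
    rw [zero_add] at this
    refine this.congr fun n => ?_
    rw [cutoffRisk, integral_div]
  filter_upwards [hlim.eventually (gt_mem_nhds hW')] with n hn W hW hmin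
  by_contra hle
  have h1 := biasTail_anti (μ := μ) hW (not_lt.1 hle)
  linarith [hmin W' hW'pos, biasTail_le_cutoffRisk (μ := μ) n W]

/-- Frequencies above the support of the Fourier transform only add variance. -/
lemma le_of_isMin (hμ : Integrable (fun y => |y|) μ) {n : ℕ} (hn : 1 ≤ n) {W₀ W : ℝ}
    (hW₀ : 0 < W₀) (hψ : ∀ w, W₀ < w → stieltjesFourier μ w = 0)
    (hmin : ∀ W' > 0, cutoffRisk μ n W ≤ cutoffRisk μ n W') : W ≤ W₀ := by
  by_contra hlt
  rw [not_le] at hlt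
  have h1 := cutoffRisk_eq_add hμ n hW₀ hlt.le
  have hpi := Real.pi_pos
  have hn0 : (0 : ℝ) < n := by positivity
  have h2 : 0 < ∫ w in Set.Ioc W₀ W, (varianceDensity μ w / n - biasDensity μ w) := by
    have hpt : ∀ w ∈ Set.Ioc W₀ W, 0 < varianceDensity μ w / n - biasDensity μ w := by
      intro w hw
      have hw0 : 0 < w := hW₀.trans hw.1
      rw [varianceDensity, biasDensity, hψ w hw.1, abs_of_pos hw0]
      simp only [norm_zero]
      norm_num
      positivity
    rw [setIntegral_pos_iff_support_of_nonneg_ae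
      ((ae_restrict_iff' measurableSet_Ioc).2 (Eventually.of_forall fun w hw => (hpt w hw).le))
      (integrableOn_Ioc_sub hμ n hW₀ W)]
    refine lt_of_lt_of_le ?_ (measure_mono (s := Set.Ioc W₀ W) fun w hw => ⟨(hpt w hw).ne', hw⟩)
    simpa using hlt
  linarith [hmin W₀ hW₀]

end RiskFunction

/-! ### Optimal bandwidths -/

section Spectrum

variable {f : ℝ → ℝ}

lemma phi_eq_conj_stieltjesFourier (hf_meas : Measurable f) (hf_nonneg : ∀ x, 0 ≤ f x) (w : ℝ) :
    phi f (2 * Real.pi * w) = starRingEnd ℂ (stieltjesFourier (densityLaw f) w) := by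
  rw [phi, stieltjesFourier, integral_densityLaw hf_meas hf_nonneg, ← integral_conj]
  refine integral_congr_ae (Eventually.of_forall fun y => ?_)
  simp only [Complex.real_smul, map_mul, Complex.conj_ofReal, ← Complex.exp_conj, Complex.conj_I]
  rw [mul_comm]
  congr 2
  push_cast
  ring

lemma phi_ne_zero_iff (hf_meas : Measurable f) (hf_nonneg : ∀ x, 0 ≤ f x) (w : ℝ) :
    phi f (2 * Real.pi * w) ≠ 0 ↔ stieltjesFourier (densityLaw f) w ≠ 0 := by
  rw [phi_eq_conj_stieltjesFourier hf_meas hf_nonneg, Ne, map_eq_zero]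

lemma stieltjesFourier_eq_zero_of_Df_le (hf_meas : Measurable f) (hf_nonneg : ∀ x, 0 ≤ f x)
    {W w : ℝ} (hW : 0 < W) (hD : Df f ≤ ENNReal.ofReal (2 * Real.pi * W)) (hw : W < w) :
    stieltjesFourier (densityLaw f) w = 0 := by
  by_contra hne
  have hpi := Real.pi_pos
  have h0 : 0 < 2 * Real.pi * w := by have := hW.trans hw; positivity
  have h1 : ENNReal.ofReal (2 * Real.pi * w) ≤ Df f :=
    le_sSup ⟨_, ⟨h0.le, (phi_ne_zero_iff hf_meas hf_nonneg w).2 hne⟩, rfl⟩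
  have h2 := (ENNReal.ofReal_le_ofReal_iff (by positivity)).1 (h1.trans hD)
  exact absurd hw (not_lt.2 (le_of_mul_le_mul_left h2 (by positivity)))

lemma exists_stieltjesFourier_ne_zero (hf_meas : Measurable f) (hf_nonneg : ∀ x, 0 ≤ f x)
    {W : ℝ} (hW : 0 < W) (hD : ENNReal.ofReal (2 * Real.pi * W) < Df f) :
    ∃ w, W < w ∧ stieltjesFourier (densityLaw f) w ≠ 0 := by
  obtain ⟨_, ⟨t, ⟨ht0, ht⟩, rfl⟩, hlt⟩ := lt_sSup_iff.1 hD
  have hpi := Real.pi_pos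
  have h1 := (ENNReal.ofReal_lt_ofReal_iff_of_nonneg (by positivity)).1 hlt
  refine ⟨t / (2 * Real.pi), ?_, ?_⟩
  · rw [lt_div_iff₀ (by positivity)]
    linarith
  · rw [← phi_ne_zero_iff hf_meas hf_nonneg]
    rwa [mul_div_cancel₀ _ (by positivity)]

/-- The Fourier transform is `1` at the origin and continuous, so that its support reaches beyond
the origin. -/
lemma Df_pos [IsProbabilityMeasure (densityLaw f)] (hf_meas : Measurable f)
    (hf_nonneg : ∀ x, 0 ≤ f x) : 0 < Df f := by
  have h0 : ∀ᶠ w in 𝓝 (0 : ℝ), stieltjesFourier (densityLaw f) w ≠ 0 :=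
    (continuous_stieltjesFourier _).continuousAt.eventually_ne (by
      rw [stieltjesFourier_zero]; exact one_ne_zero)
  obtain ⟨ε, hε, hball⟩ := Metric.eventually_nhds_iff.1 h0
  have hpi := Real.pi_pos
  have h1 := hball (y := ε / 2) (by rw [Real.dist_eq, sub_zero, abs_of_pos] <;> linarith)
  refine (ENNReal.ofReal_pos.2 (by positivity : 0 < 2 * Real.pi * (ε / 2))).trans_le ?_
  exact le_sSup ⟨_, ⟨by positivity, (phi_ne_zero_iff hf_meas hf_nonneg _).2 h1⟩, rfl⟩

lemma tendsto_norm_stieltjesFourier (hf_meas : Measurable f) (hf_nonneg : ∀ x, 0 ≤ f x) :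
    Tendsto (fun w => ‖stieltjesFourier (densityLaw f) w‖) atTop (𝓝 0) := by
  rw [stieltjesFourier_densityLaw hf_meas hf_nonneg]
  simpa using ((Real.zero_at_infty_fourier fun x => (f x : ℂ)).mono_left atTop_le_cocompact).norm

lemma le_ofReal_inv_iff {D : ℝ≥0∞} {h : ℝ} (hh : 0 < h) :
    D ≤ ENNReal.ofReal h⁻¹ ↔ ENNReal.ofReal h ≤ 1 / D := by
  rw [ENNReal.ofReal_inv_of_pos hh, one_div, ENNReal.le_inv_iff_le_inv]

end Spectrum

section Optimal

variable {Ω : Type*} [MeasurableSpace Ω] {P : Measure Ω} [IsProbabilityMeasure P]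
  {X : ℕ → Ω → ℝ} {f : ℝ → ℝ} [IsProbabilityMeasure (densityLaw f)]

lemma MISE_eq_cutoffRisk (hf_meas : Measurable f) (hf_nonneg : ∀ x, 0 ≤ f x)
    (hX_indep : iIndepFun X P) (hX_law : ∀ j, HasLaw (X j) (densityLaw f) P)
    (hf_sq : MemLp f 2 volume) (hf_mean : Integrable (fun x : ℝ => |x| * f x) volume) {n : ℕ}
    (hn : 1 ≤ n) {h : ℝ} (hh : 0 < h) :
    MISE P X f n h
      = ENNReal.ofReal (2 * cutoffRisk (densityLaw f) n (1 / (2 * Real.pi * h))) := by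
  have hpi := Real.pi_pos
  have hW : 0 < 1 / (2 * Real.pi * h) := by positivity
  have hμ := integrable_abs_densityLaw hf_meas hf_nonneg hf_mean
  rw [MISE_eq hf_meas hf_nonneg hX_indep hX_law hf_sq hf_mean hn hh, cutoffRisk, biasTail]
  exact lintegral_ofReal_ite_abs (a := fun w => varianceDensity (densityLaw f) w / n)
    (fun w => by simp only [varianceDensity_abs]) biasDensity_abs
    (fun w => div_nonneg (varianceDensity_nonneg _ w) (Nat.cast_nonneg n)) (biasDensity_nonneg _)
    hW ((integrable_varianceDensity hμ).div_const _) (integrableOn_biasDensity hW)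

lemma ISB_eq_biasTail (hf_meas : Measurable f) (hf_nonneg : ∀ x, 0 ≤ f x)
    (hX_law : ∀ j, HasLaw (X j) (densityLaw f) P)
    (hf_sq : MemLp f 2 volume) (hf_mean : Integrable (fun x : ℝ => |x| * f x) volume) {n : ℕ}
    (hn : 1 ≤ n) {h : ℝ} (hh : 0 < h) :
    ISB P X f n h = ENNReal.ofReal (2 * biasTail (densityLaw f) (1 / (2 * Real.pi * h))) := by
  have hpi := Real.pi_pos
  have hW : 0 < 1 / (2 * Real.pi * h) := by positivity
  rw [ISB_eq hf_meas hf_nonneg hX_law hf_sq hf_mean hn hh, biasTail,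
    lintegral_ofReal_ite_abs (a := fun _ => 0) (fun w => rfl) biasDensity_abs (fun w => le_rfl)
      (biasDensity_nonneg _) hW (integrable_zero _ _ _) (integrableOn_biasDensity hW)]
  simp

lemma isOptimalBandwidth_iff (hf_meas : Measurable f) (hf_nonneg : ∀ x, 0 ≤ f x)
    (hX_indep : iIndepFun X P) (hX_law : ∀ j, HasLaw (X j) (densityLaw f) P)
    (hf_sq : MemLp f 2 volume) (hf_mean : Integrable (fun x : ℝ => |x| * f x) volume) {n : ℕ}
    (hn : 1 ≤ n) {h : ℝ} (hh : 0 < h) :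
    IsOptimalBandwidth P X f n h ↔ ∀ W' > 0,
      cutoffRisk (densityLaw f) n (1 / (2 * Real.pi * h)) ≤ cutoffRisk (densityLaw f) n W' := by
  have hpi := Real.pi_pos
  have key : ∀ h' : ℝ, 0 < h' → (MISE P X f n h ≤ MISE P X f n h' ↔
      cutoffRisk (densityLaw f) n (1 / (2 * Real.pi * h))
        ≤ cutoffRisk (densityLaw f) n (1 / (2 * Real.pi * h'))) := fun h' hh' => by
    have h0 := cutoffRisk_nonneg (μ := densityLaw f) n (1 / (2 * Real.pi * h'))
    rw [MISE_eq_cutoffRisk hf_meas hf_nonneg hX_indep hX_law hf_sq hf_mean hn hh,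
      MISE_eq_cutoffRisk hf_meas hf_nonneg hX_indep hX_law hf_sq hf_mean hn hh',
      ENNReal.ofReal_le_ofReal_iff (by positivity), mul_le_mul_iff_right₀ two_pos]
  constructor
  · rintro ⟨-, hmin⟩ W' hW'
    have hh' : 0 < 1 / (2 * Real.pi * W') := by positivity
    have e : 1 / (2 * Real.pi * (1 / (2 * Real.pi * W'))) = W' := by field_simp
    have := (key _ hh').1 (hmin _ hh')
    rwa [e] at this
  · exact fun hmin => ⟨hh, fun h' hh' => (key h' hh').2 (hmin _ (by positivity))⟩

lemma ISB_eq_zero_iff (hf_meas : Measurable f) (hf_nonneg : ∀ x, 0 ≤ f x)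
    (hX_law : ∀ j, HasLaw (X j) (densityLaw f) P)
    (hf_sq : MemLp f 2 volume) (hf_mean : Integrable (fun x : ℝ => |x| * f x) volume) {n : ℕ}
    (hn : 1 ≤ n) {h : ℝ} (hh : 0 < h) :
    ISB P X f n h = 0 ↔ ENNReal.ofReal h ≤ 1 / Df f := by
  have hpi := Real.pi_pos
  have hW : 0 < 1 / (2 * Real.pi * h) := by positivity
  have e : 2 * Real.pi * (1 / (2 * Real.pi * h)) = h⁻¹ := by field_simp
  rw [ISB_eq_biasTail hf_meas hf_nonneg hX_law hf_sq hf_mean hn hh, ENNReal.ofReal_eq_zero,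
    ← le_ofReal_inv_iff hh, ← e]
  constructor
  · intro h0
    by_contra hlt
    obtain ⟨w, hw, hψ⟩ := exists_stieltjesFourier_ne_zero hf_meas hf_nonneg hW (not_le.1 hlt)
    linarith [biasTail_pos hW hw hψ]
  · intro hD
    have : biasTail (densityLaw f) (1 / (2 * Real.pi * h)) = 0 := by
      refine setIntegral_eq_zero_of_forall_eq_zero fun w hw => ?_
      rw [biasDensity, stieltjesFourier_eq_zero_of_Df_le hf_meas hf_nonneg hW hD hw]
      simp
    rw [this, mul_zero]

/-- The supremum is attained: `1 / D_f` is finite, and if it is `0` then the bandwidth `0` has no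
bias. -/
lemma hStar_eq (hf_meas : Measurable f) (hf_nonneg : ∀ x, 0 ≤ f x)
    (hX_law : ∀ j, HasLaw (X j) (densityLaw f) P)
    (hf_sq : MemLp f 2 volume) (hf_mean : Integrable (fun x : ℝ => |x| * f x) volume) {n : ℕ}
    (hn : 1 ≤ n) : hStar P X f n = 1 / Df f := by
  have hiff := fun (h : ℝ) (hh : 0 < h) =>
    ISB_eq_zero_iff hf_meas hf_nonneg hX_law hf_sq hf_mean hn hh
  apply le_antisymm
  · refine sSup_le ?_
    rintro _ ⟨h, ⟨hh, h0⟩, rfl⟩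
    rcases hh.eq_or_lt with rfl | hh
    · simp
    · exact (hiff h hh).1 h0
  · have hfin : 1 / Df f ≠ ⊤ := by
      simpa using (Df_pos hf_meas hf_nonneg).ne'
    have hmem : 0 ≤ (1 / Df f).toReal ∧ ISB P X f n (1 / Df f).toReal = 0 := by
      refine ⟨ENNReal.toReal_nonneg, ?_⟩
      rcases (ENNReal.toReal_nonneg (a := 1 / Df f)).eq_or_lt with h | h
      · rw [← h]
        exact ISB_zero hf_meas hf_nonneg hX_law hn
      · exact (hiff _ h).2 (ENNReal.ofReal_toReal hfin).le
    exact le_sSup ⟨_, hmem, ENNReal.ofReal_toReal hfin⟩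

lemma tendsto_optimalBandwidth (hf_meas : Measurable f) (hf_nonneg : ∀ x, 0 ≤ f x)
    (hX_indep : iIndepFun X P) (hX_law : ∀ j, HasLaw (X j) (densityLaw f) P)
    (hf_sq : MemLp f 2 volume) (hf_mean : Integrable (fun x : ℝ => |x| * f x) volume)
    {h₀ : ℕ → ℝ} (hopt : ∀ n : ℕ, 1 ≤ n → IsOptimalBandwidth P X f n (h₀ n)) :
    Tendsto (fun n => ENNReal.ofReal (h₀ n)) atTop (𝓝 (1 / Df f)) := by
  have hpi := Real.pi_pos
  have hμ := integrable_abs_densityLaw hf_meas hf_nonneg hf_mean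
  have hmin := fun (n : ℕ) (hn : 1 ≤ n) => (isOptimalBandwidth_iff hf_meas hf_nonneg hX_indep
    hX_law hf_sq hf_mean hn (hopt n hn).1).1 (hopt n hn)
  have hDpos := Df_pos hf_meas hf_nonneg
  -- the lower bound `1 / D_f ≤ h₀ n` holds for each sample size
  have hlow : ∀ n, 1 ≤ n → 1 / Df f ≤ ENNReal.ofReal (h₀ n) := by
    intro n hn
    have hh := (hopt n hn).1
    rcases eq_or_ne (Df f) ⊤ with hD | hD
    · simp [hD]
    have hd : 0 < (Df f).toReal := ENNReal.toReal_pos hDpos.ne' hD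
    have e1 : ENNReal.ofReal (2 * Real.pi * ((Df f).toReal / (2 * Real.pi))) = Df f := by
      rw [mul_div_cancel₀ _ (by positivity), ENNReal.ofReal_toReal hD]
    have h1 := le_of_isMin hμ hn (W₀ := (Df f).toReal / (2 * Real.pi)) (by positivity)
      (fun w hw => stieltjesFourier_eq_zero_of_Df_le hf_meas hf_nonneg (by positivity) e1.ge hw)
      (hmin n hn)
    have h2 : (h₀ n)⁻¹ ≤ (Df f).toReal := by
      rw [div_le_div_iff₀ (by positivity) (by positivity)] at h1
      rw [inv_le_iff_one_le_mul₀ hh]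
      nlinarith
    rw [one_div, ENNReal.inv_le_iff_inv_le, ← ENNReal.ofReal_inv_of_pos hh]
    exact ENNReal.ofReal_le_of_le_toReal h2
  refine tendsto_order.2 ⟨fun a ha => ?_, fun a ha => ?_⟩
  · filter_upwards [eventually_ge_atTop 1] with n hn
    exact ha.trans_le (hlow n hn)
  · obtain ⟨c, hc1, hc2⟩ := exists_between ha
    have hctop : c ≠ ⊤ := (hc2.trans_le le_top).ne
    have hc0 : 0 < c.toReal := ENNReal.toReal_pos (zero_le.trans_lt hc1).ne' hctop
    have e : 2 * Real.pi * (1 / (2 * Real.pi * c.toReal)) = c.toReal⁻¹ := by field_simp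
    have hW : 0 < 1 / (2 * Real.pi * c.toReal) := by positivity
    have hD : ENNReal.ofReal (2 * Real.pi * (1 / (2 * Real.pi * c.toReal))) < Df f := by
      rw [e, ← not_le, le_ofReal_inv_iff hc0, ENNReal.ofReal_toReal hctop]
      exact not_le.2 hc1
    obtain ⟨w, hw, hψ⟩ := exists_stieltjesFourier_ne_zero hf_meas hf_nonneg hW hD
    filter_upwards [eventually_lt_of_isMin (biasTail_pos hW hw hψ), eventually_ge_atTop 1]
      with n hn hn1
    have hh := (hopt n hn1).1
    have h1 := hn _ (by positivity) (hmin n hn1)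
    refine lt_trans ?_ hc2
    rw [ENNReal.ofReal_lt_iff_lt_toReal hh.le hctop]
    rw [div_lt_div_iff₀ (by positivity) (by positivity), one_mul, one_mul] at h1
    exact lt_of_mul_lt_mul_left h1 (by positivity)

end Optimal

end SincKDE

end

theorem theorem3 {Ω : Type*} [MeasurableSpace Ω] (P : Measure Ω) [IsProbabilityMeasure P]
    (X : ℕ → Ω → ℝ) (f : ℝ → ℝ) (hf_meas : Measurable f) (hf_nonneg : ∀ x, 0 ≤ f x)
    (hX_indep : iIndepFun X P)
    (hX_law : ∀ j, HasLaw (X j) (volume.withDensity (fun x => ENNReal.ofReal (f x))) P)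
    (hf_sq : MemLp f 2 volume)
    (hf_mean : Integrable (fun x : ℝ => |x| * f x) volume) :
    (∀ n : ℕ, 1 ≤ n →
      (∀ h : ℝ, 0 < h → SincKDE.MISE P X f n h < ⊤) ∧
      ∃ h : ℝ, SincKDE.IsOptimalBandwidth P X f n h) ∧
    (SincKDE.Cf f = SincKDE.Df f →
      (∀ h₀ : ℕ → ℝ, (∀ n : ℕ, 1 ≤ n → SincKDE.IsOptimalBandwidth P X f n (h₀ n)) →
        Tendsto (fun n => ENNReal.ofReal (h₀ n)) atTop (𝓝 (1 / SincKDE.Df f))) ∧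
      ∀ n : ℕ, 1 ≤ n → SincKDE.hStar P X f n = 1 / SincKDE.Df f) := by
  have hμ : IsProbabilityMeasure (SincKDE.densityLaw f) :=
    (hX_law 0).isProbabilityMeasure_iff.1 inferInstance
  have hpi := Real.pi_pos
  refine ⟨fun n hn => ⟨fun h hh => ?_, ?_⟩, fun _ => ⟨fun h₀ hopt => ?_, fun n hn => ?_⟩⟩
  · rw [SincKDE.MISE_eq_cutoffRisk hf_meas hf_nonneg hX_indep hX_law hf_sq hf_mean hn hh]
    exact ENNReal.ofReal_lt_top
  · obtain ⟨W, hW, hmin⟩ := SincKDE.exists_cutoffRisk_min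
      (SincKDE.integrable_abs_densityLaw hf_meas hf_nonneg hf_mean)
      (SincKDE.tendsto_norm_stieltjesFourier hf_meas hf_nonneg) hn
    have hh : 0 < 1 / (2 * Real.pi * W) := by positivity
    refine ⟨1 / (2 * Real.pi * W), (SincKDE.isOptimalBandwidth_iff hf_meas hf_nonneg hX_indep
      hX_law hf_sq hf_mean hn hh).2 ?_⟩
    rwa [show 1 / (2 * Real.pi * (1 / (2 * Real.pi * W))) = W by field_simp]
  · exact SincKDE.tendsto_optimalBandwidth hf_meas hf_nonneg hX_indep hX_law hf_sq hf_mean hopt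
  · exact SincKDE.hStar_eq hf_meas hf_nonneg hX_law hf_sq hf_mean hn
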